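/- **Setting.** Let $X$ be a measurable space of problems, $\Sigma$ a finite set of reasoning steps, and $T,k\in\mathbb N$ with $kT|\Sigma|\ge 2$. A verifier is a function $h:X\times\Sigma^*\to\{\text{YES},\text{NO}\}$ (with $\{x: h(x,\tau)=\text{YES}\}$ measurable for each $\tau$). It is run on a trace $\tau=(x_1,\dots,x_T)$ by evaluating it on all prefixes $(x_1),\dots,(x_1,\dots,x_T)$, and it accepts $\tau$ if all answers are YES; $C_h(x)\subseteq\Sigma^T$ is the set of accepted traces. Let $H$ be a class of verifiers that contains a countable subclass $H_0$ such that every $h\in H$ is the pointwise limit of a sequence in $H_0$ (a standard measurability condition, automatic if $X$ or $H$ is countable). For a set $G\subseteq\Sigma^T$ of gold-standard traces of a problem, let $\mathcal T_G$ be the tree whose nodes are the empty trace (root) and all prefixes of traces in $G$. The augmented examples of the problem are all one-step extensions $(p,s)$, $s\in\Sigma$, of nodes $p$ of $\mathcal T_G$ of length $<T$; they are labelled YES if they lie in $\mathcal T_G$ and NO otherwise (one-step deviations). A verifier $h^*\in H$ realizes the gold-standard reasoner $g$ if for every $x\in X$, $g(x)=C_{h^*}(x)$ and $h^*$ answers NO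 on every one-step deviation from $\mathcal T_{g(x)}$. A verifier $h$ is $1$-complete with respect to $g$ on $x$ if for every distribution $\tilde D$ over $g(x)$ the mass $\tilde D(C_h(x)\cap g(x))$ is $1$, and sound on $x$ if $C_h(x)\subseteq g(x)$. A learner maps a sample $(x_i,g(x_i))_{i\le m}$ to a verifier, which need not lie in $H$. It TVPAC-learns $H$ with sample size $M(\epsilon,\delta)$ if for every $h^*\in H$, every $g$ realized by $h^*$ with $|g(x)|\le k$ for all $x$, all $\epsilon,\delta\in(0,1)$, every probability distribution $D$ on $X$ and every $m\ge M(\epsilon,\delta)$: with probability at least $1-\delta$ over $x_1,\dots,x_m\sim D$ i.i.d., the output $h$ satisfies $$\Pr_{x\sim D}[h\text{ is 1-complete w.r.t. }g\text{ and sound on }x]\ge 1-\epsilon .$$ **Theorem.** There is a universal constant $C>0$ such that, in this setting, if $H$ has finite VC dimension $\mathrm{VCDim}(H)$ (as a class of functions on $X\times\Sigma^*$), then: 1. $H$ is TVPAC-learnable (by some learner) with sample size $$\frac{C}{\epsilon}\Big(\mathrm{VCDim}(H)\log(kT|\Sigma|)+\log\frac1\delta\Big).$$ 2. Every learner that performs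 empirical risk minimization over $H$ on the augmented sample (all augmented examples of all the sampled problems) TVPAC-learns $H$ with sample size $$\frac{C}{\epsilon}\Big(\mathrm{VCDim}(H)\log\frac{kT|\Sigma|}{\epsilon}+\log\frac1\delta\Big).$$ -/

import Mathlib

open MeasureTheory Filter
open scoped ENNReal

universe u v

namespace TVPAC

/-- A verifier: it takes a problem `x` and a finite sequence `τ` of reasoning steps, and answers
YES (`true`) or NO (`false`) about the last step of `τ`. -/
abbrev Verifier (X : Type u) (Step : Type v) : Type (max u v) := X → List Step → Bool

section Basic

variable {X : Type u} {Step : Type v}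

/-- `C_h(x)`: the traces of length `T` that `h` accepts on problem `x`. A verifier is run on a trace
by evaluating it on every prefix `(x₁), (x₁, x₂), …, (x₁, …, x_T)`, and it accepts the trace when
all the answers are YES. -/
def accepted (T : ℕ) (h : Verifier X Step) (x : X) : Set (List Step) :=
  {τ | τ.length = T ∧ ∀ j, 1 ≤ j → j ≤ T → h x (τ.take j) = true}

/-- `h` `γ`-completely verifies `x` with respect to the set `G` of gold-standard traces of `x` and
the distribution `ν` over traces. -/
def CompletelyVerifies (T : ℕ) (γ : ℝ≥0∞) (h : Verifier X Step) (x : X) (G : Set (List Step))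
    (ν : PMF (List Step)) : Prop :=
  γ ≤ ν.toOuterMeasure (accepted T h x ∩ G)

/-- `1`-completeness with respect to `G`: for all distributions over traces in `G`. -/
def OneComplete (T : ℕ) (h : Verifier X Step) (x : X) (G : Set (List Step)) : Prop :=
  ∀ ν : PMF (List Step), ν.support ⊆ G → CompletelyVerifies T 1 h x G ν

/-- `h` soundly verifies `x`: every accepted trace is a gold-standard trace. -/
def Sound (T : ℕ) (h : Verifier X Step) (x : X) (G : Set (List Step)) : Prop :=
  accepted T h x ⊆ G

theorem oneComplete_iff (T : ℕ) (h : Verifier X Step) (x : X) (G : Set (List Step)) :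
    OneComplete T h x G ↔ G ⊆ accepted T h x := by
  constructor
  · intro H τ hτ
    have h1 := H (PMF.pure τ) (by simpa using hτ)
    unfold CompletelyVerifies at h1
    rw [PMF.toOuterMeasure_pure_apply] at h1
    by_contra hn
    rw [if_neg (fun hh => hn hh.1)] at h1
    simp at h1
  · intro H ν hν
    unfold CompletelyVerifies
    rw [Set.inter_eq_self_of_subset_right H]
    exact ((PMF.toOuterMeasure_apply_eq_one_iff ν _).2 hν).ge

/-- The nodes of the tree of gold-standard traces, each node being identified with the path that
leads to it: the root (the problem itself) and all prefixes of gold-standard traces. -/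
def goldTree (G : Set (List Step)) : Set (List Step) :=
  {τ | τ = [] ∨ ∃ ρ ∈ G, τ <+: ρ}

/-- The traces of the augmented sample that are created from a problem with set `G` of gold-standard
traces: all one-step extensions of nodes of the tree that are not complete traces. Those inside the
tree (the sub-traces of gold-standard traces) are positive examples; those outside (the one-step
deviations) are negative examples. -/
def augmented (T : ℕ) (G : Set (List Step)) : Set (List Step) :=
  {τ | ∃ p s, p ∈ goldTree G ∧ p.length < T ∧ τ = p ++ [s]}

theorem augmented_finite [Finite Step] (T : ℕ) (G : Set (List Step)) :
    (augmented T G).Finite := by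
  refine (List.finite_length_le Step T).subset ?_
  rintro τ ⟨p, s, -, hp, rfl⟩
  simp only [Set.mem_ofPred_eq, List.length_append, List.length_cons, List.length_nil]
  omega

/-- The gold-standard reasoner `g` is realized by the verifier `hstar`: on every problem `hstar`
accepts exactly the gold-standard traces, and it rejects the first step that leaves the tree of
gold-standard traces. -/
def Realizes (T : ℕ) (hstar : Verifier X Step) (g : X → Set (List Step)) : Prop :=
  ∀ x, g x = accepted T hstar x ∧
    ∀ τ ∈ augmented T (g x), τ ∉ goldTree (g x) → hstar x τ = false

/-- A learner: it receives `m` problems, each together with its set of gold-standard traces, and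
outputs a verifier. -/
abbrev Learner (X : Type u) (Step : Type v) : Type (max u v) :=
  (m : ℕ) → (Fin m → X × Set (List Step)) → Verifier X Step

/-- The number of augmented examples of the sample `S` on which `h` errs. -/
noncomputable def empiricalRisk (T : ℕ) {m : ℕ} (S : Fin m → X × Set (List Step))
    (h : Verifier X Step) : ℕ :=
  ∑ i, {τ ∈ augmented T (S i).2 | ¬ (h (S i).1 τ = true ↔ τ ∈ goldTree (S i).2)}.ncard

/-- `A` performs empirical risk minimization over `H` on the augmented sample. -/
def IsERM (T : ℕ) (H : Set (Verifier X Step)) (A : Learner X Step) : Prop :=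
  ∀ (m : ℕ) (S : Fin m → X × Set (List Step)),
    A m S ∈ H ∧ ∀ h ∈ H, empiricalRisk T S (A m S) ≤ empiricalRisk T S h

/-- `H` shatters the finite set `P` of problem-trace pairs. -/
def Shatters (H : Set (Verifier X Step)) (P : Finset (X × List Step)) : Prop :=
  ∀ Q ⊆ P, ∃ h ∈ H, ∀ p ∈ P, h p.1 p.2 = true ↔ p ∈ Q

/-- The VC dimension of a class of verifiers on the domain `X × Step*`. -/
noncomputable def vcDim (H : Set (Verifier X Step)) : ℕ∞ :=
  ⨆ (P : Finset (X × List Step)) (_ : Shatters H P), (P.card : ℕ∞)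

/-- `H` has a countable subclass such that every member of `H` is a pointwise limit of a sequence in
the subclass. -/
def PointwiseSeparable (H : Set (Verifier X Step)) : Prop :=
  ∃ H₀ ⊆ H, H₀.Countable ∧ ∀ h ∈ H, ∃ u : ℕ → Verifier X Step, (∀ n, u n ∈ H₀) ∧
    ∀ x τ, ∀ᶠ n in atTop, u n x τ = h x τ

/-- `A` trustably-verifiably-PAC learns `H` with sample size `M ε δ`, when every problem has at most
`k` gold-standard traces, all of length `T`. Probabilities of failure are outer measures, so that
the condition is the strong one even where an event is not measurable. -/
def TVPACLearns [MeasurableSpace X] (T k : ℕ) (H : Set (Verifier X Step)) (A : Learner X Step)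
    (M : ℝ → ℝ → ℝ) : Prop :=
  ∀ hstar ∈ H, ∀ g : X → Set (List Step), Realizes T hstar g → (∀ x, (g x).encard ≤ k) →
    ∀ ε δ : ℝ, 0 < ε → ε < 1 → 0 < δ → δ < 1 →
    ∀ (D : Measure X) [IsProbabilityMeasure D] (m : ℕ), M ε δ ≤ m →
      Measure.pi (fun _ : Fin m => D)
        {S | ENNReal.ofReal ε <
          D {x | ¬ (OneComplete T (A m fun i => (S i, g (S i))) x (g x) ∧
                    Sound T (A m fun i => (S i, g (S i))) x (g x))}} ≤ ENNReal.ofReal δ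

end Basic

end TVPAC

namespace TVPAC

/-! A verifier that is right on every augmented example of a problem is complete and sound on it, so
it suffices to control the error sets `{x | Errs T h x (g x)}`. On `n` problems these sets are
determined by the labels of at most `N * n` augmented examples, `N = k * T * |Step|`. Sauer-Shelah
therefore bounds their traces by `r⁻ᵈ (1 + r) ^ (N * n)` for every `r ∈ (0, 1]` (`traceBound_errs`).

This weighted count feeds an ε-net theorem proved by a ghost sample and random swaps, with an
exponential weight in place of Chebyshev (`measure_exists_missed_mul_le`). Inside a region of
measure at most `p` it gives failure probability `(16pN/ε)^d exp(-mε/4)`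
(`measure_exists_consistent_inter_le`). With `p = 1` this is the bound for empirical risk
minimization, where `log (1/ε)` comes from `1/ε` inside the power.

The logarithm disappears if `p` is of order `ε`. This is arranged by Hanneke-style recursive
subsampling: three groups of hypotheses, each trained without one of three fresh blocks. If the
overall majority errs, the majority of some group `i` errs, and so does a constant fraction of the
other two groups. The error region of group `i` is independent of block `i`, has measure at most `p`
by induction, and is tested by block `i`, on which the other groups were trained. Blocks grow by a
factor 4 per level and the error shrinks at the same rate (`measure_majorityError_gt_le`); the
majority vote is an improper learner. -/

/-! ### Symmetrization and the ε-net theorem -/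

theorem lintegral_fin_prod_eq_pow {X : Type*} [MeasurableSpace X] (D : Measure X)
    [SigmaFinite D] {f : X → ℝ≥0∞} (hf : Measurable f) (n : ℕ) :
    ∫⁻ x : Fin n → X, ∏ i, f (x i) ∂(Measure.pi fun _ => D) = (∫⁻ x, f x ∂D) ^ n := by
  induction n with
  | zero => simp
  | succ n ih =>
    have hm : Measurable fun x : Fin n → X => ∏ i, f (x i) := by fun_prop
    rw [← ((measurePreserving_piFinSuccAbove (fun _ : Fin (n + 1) => D) 0).symm).lintegral_comp_emb
      (MeasurableEquiv.measurableEmbedding _)]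
    simp_rw [MeasurableEquiv.piFinSuccAbove_symm_apply, Fin.insertNthEquiv,
      Fin.prod_univ_succ, Fin.insertNth_zero, Equiv.coe_fn_mk, Fin.cons_succ, Fin.cons_zero,
      cast_eq]
    rw [lintegral_prod_mul (f := f) (g := fun x : Fin n → X => ∏ i, f (x i)) hf.aemeasurable
      hm.aemeasurable, ih, pow_succ']

theorem lintegral_pi_prod_eq_pow {ι X : Type*} [Fintype ι] [MeasurableSpace X] (D : Measure X)
    [SigmaFinite D] {f : X → ℝ≥0∞} (hf : Measurable f) :
    ∫⁻ x : ι → X, ∏ i, f (x i) ∂(Measure.pi fun _ => D) =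
      (∫⁻ x, f x ∂D) ^ Fintype.card ι := by
  let e := (Fintype.equivFin ι).symm
  rw [← (measurePreserving_piCongrLeft (fun _ : ι => D) e).lintegral_comp_emb
    (MeasurableEquiv.measurableEmbedding _)]
  simp_rw [← e.prod_comp, MeasurableEquiv.coe_piCongrLeft, Equiv.piCongrLeft_apply_apply]
  exact lintegral_fin_prod_eq_pow D hf _

/-- The factor contributed by a pair of points, the first from the sample and the second from the
ghost sample, to the weight of the set `c`. -/
noncomputable def pairWeight {X : Type*} (c : Set X) (z : X × X) : ℝ≥0∞ :=
  cᶜ.indicator 1 z.1 * (1 + c.indicator 1 z.2)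

theorem measurable_pairWeight {X : Type*} [MeasurableSpace X] {c : Set X} (hc : MeasurableSet c) :
    Measurable (pairWeight c) := by
  unfold pairWeight
  have h1 : Measurable (cᶜ.indicator (1 : X → ℝ≥0∞)) := measurable_one.indicator hc.compl
  have h2 : Measurable (c.indicator (1 : X → ℝ≥0∞)) := measurable_one.indicator hc
  fun_prop

/-- The sum is 0 if both points lie in `c` and 2 otherwise. Thus a random swap has mean weight at
most 1, whatever `c` is. -/
theorem pairWeight_add_swap_le {X : Type*} (c : Set X) (z : X × X) :
    pairWeight c z + pairWeight c z.swap ≤ 2 := by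
  unfold pairWeight
  by_cases h1 : z.1 ∈ c <;> by_cases h2 : z.2 ∈ c <;> simp [h1, h2, one_add_one_eq_two]

theorem pairWeight_congr {X : Type*} {c c' : Set X} {z : X × X} (h1 : z.1 ∈ c ↔ z.1 ∈ c')
    (h2 : z.2 ∈ c ↔ z.2 ∈ c') : pairWeight c z = pairWeight c' z := by
  classical
  simp [pairWeight, Set.indicator_apply, h1, h2]

/-- Exchange of the sample and the ghost sample at the positions selected by `σ`. -/
def swapAt {ι X : Type*} (σ : ι → Bool) (Z : ι → X × X) : ι → X × X :=
  fun i => if σ i then (Z i).swap else Z i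

theorem measurePreserving_swapAt {ι X : Type*} [Fintype ι] [MeasurableSpace X] (D : Measure X)
    [SigmaFinite D] (σ : ι → Bool) :
    MeasurePreserving (swapAt σ) (Measure.pi fun _ : ι => D.prod D)
      (Measure.pi fun _ : ι => D.prod D) := by
  refine measurePreserving_pi (fun _ : ι => D.prod D) (fun _ : ι => D.prod D)
    (f := fun i z => if σ i then z.swap else z) fun i => ?_
  cases σ i
  · simpa using! MeasurePreserving.id _
  · simpa using Measure.measurePreserving_swap

theorem sum_prod_pairWeight_le {ι X : Type*} [Fintype ι] [DecidableEq ι] (c : Set X)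
    (Z : ι → X × X) :
    ∑ σ : ι → Bool, ∏ i, pairWeight c (swapAt σ Z i) ≤ 2 ^ Fintype.card ι := by
  have h := Finset.prod_univ_sum (fun _ : ι => (Finset.univ : Finset Bool))
    (fun i b => pairWeight c (if b then (Z i).swap else Z i))
  rw [Fintype.piFinset_univ] at h
  calc ∑ σ : ι → Bool, ∏ i, pairWeight c (swapAt σ Z i)
      = ∏ i, ∑ b : Bool, pairWeight c (if b then (Z i).swap else Z i) := h.symm
    _ ≤ ∏ _i : ι, 2 := by
        refine Finset.prod_le_prod' fun i _ => ?_
        simpa [add_comm] using pairWeight_add_swap_le c (Z i)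
    _ = 2 ^ Fintype.card ι := by simp

/-- The largest weight of a pair of samples for a set of measure more than `ε`. -/
noncomputable def supWeight {ι X : Type*} [Fintype ι] [MeasurableSpace X] (D : Measure X)
    (C : ℕ → Set X) (ε : ℝ≥0∞) (Z : ι → X × X) : ℝ≥0∞ :=
  ⨆ n, ⨆ (_ : ε < D (C n)), ∏ i, pairWeight (C n) (Z i)

theorem measurable_supWeight {ι X : Type*} [Fintype ι] [MeasurableSpace X] (D : Measure X)
    {C : ℕ → Set X} (hC : ∀ n, MeasurableSet (C n)) (ε : ℝ≥0∞) :
    Measurable (supWeight (ι := ι) D C ε) := by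
  unfold supWeight
  refine Measurable.iSup fun n => Measurable.iSup fun _ => ?_
  have := measurable_pairWeight (hC n)
  fun_prop

/-- Once the sample misses `c`, each ghost point contributes an independent factor of mean `1 + D
c`. This exponential gain is what the swaps cannot produce. -/
theorem lintegral_prod_pairWeight {ι X : Type*} [Fintype ι] [MeasurableSpace X] (D : Measure X)
    [IsProbabilityMeasure D] {c : Set X} (hc : MeasurableSet c) {S : ι → X} (hS : ∀ i, S i ∉ c) :
    ∫⁻ S', ∏ i, pairWeight c (S i, S' i) ∂(Measure.pi fun _ : ι => D) =
      (1 + D c) ^ Fintype.card ι := by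
  have h2 : Measurable (c.indicator (1 : X → ℝ≥0∞)) := measurable_one.indicator hc
  have h : ∀ (S' : ι → X) i, pairWeight c (S i, S' i) = 1 + c.indicator 1 (S' i) := by
    intro S' i
    simp [pairWeight, hS i]
  simp_rw [h]
  rw [lintegral_pi_prod_eq_pow (f := fun x => 1 + c.indicator 1 x) D (by fun_prop),
    lintegral_add_left measurable_const, lintegral_indicator_one hc]
  simp

theorem measure_mul_le_lintegral_supWeight {ι X : Type*} [Fintype ι] [MeasurableSpace X]
    (D : Measure X) [IsProbabilityMeasure D] {C : ℕ → Set X} (hC : ∀ n, MeasurableSet (C n))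
    (ε : ℝ≥0∞) :
    (Measure.pi fun _ : ι => D) {S | ∃ n, ε < D (C n) ∧ ∀ i, S i ∉ C n} *
        (1 + ε) ^ Fintype.card ι ≤
      ∫⁻ Z, supWeight D C ε Z ∂(Measure.pi fun _ : ι => D.prod D) := by
  set U : Set (ι → X) := {S | ∃ n, ε < D (C n) ∧ ∀ i, S i ∉ C n} with hU
  have hUm : MeasurableSet U := by
    have : U = ⋃ n, ⋃ (_ : ε < D (C n)), ⋂ i, (fun S : ι → X => S i) ⁻¹' (C n)ᶜ := by
      ext S; simp [hU]
    rw [this]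
    exact MeasurableSet.iUnion fun n => MeasurableSet.iUnion fun _ => MeasurableSet.iInter fun i =>
      (hC n).compl.preimage (measurable_pi_apply i)
  have hF := measurable_supWeight (ι := ι) D hC ε
  have e := (measurePreserving_arrowProdEquivProdArrow X X ι (fun _ => D) (fun _ => D)).symm
  rw [← e.lintegral_comp hF, lintegral_prod _ (by
      exact (hF.comp (MeasurableEquiv.measurable _)).aemeasurable), mul_comm,
    ← lintegral_indicator_const hUm]
  refine lintegral_mono fun S => ?_
  by_cases hS : S ∈ U
  · obtain ⟨n, hn, hSn⟩ := hS
    rw [Set.indicator_of_mem (show S ∈ U from ⟨n, hn, hSn⟩)]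
    calc (1 + ε) ^ Fintype.card ι ≤ (1 + D (C n)) ^ Fintype.card ι := by gcongr
      _ = ∫⁻ S', ∏ i, pairWeight (C n) (S i, S' i) ∂(Measure.pi fun _ : ι => D) :=
          (lintegral_prod_pairWeight D (hC n) hSn).symm
      _ ≤ _ := lintegral_mono fun S' => by
          unfold supWeight
          exact le_iSup₂_of_le n hn le_rfl
  · simp [Set.indicator_of_notMem hS]

/-- Swaps do not change the underlying set `P` of sample and ghost points, so one finite list of
traces on `P` serves all `σ`. The supremum is bounded by the sum over traces, and each trace
contributes at most `2 ^ card ι`. -/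
theorem sum_supWeight_swapAt_le {ι X : Type*} [Fintype ι] [DecidableEq ι] [MeasurableSpace X]
    (D : Measure X) {C : ℕ → Set X} (ε : ℝ≥0∞) {W : X → ℝ≥0∞} (h1 : ∀ x, 1 ≤ W x) {K : ℝ≥0∞}
    (hK : ∀ P : Finset X,
      ((Set.range fun n => (P ∩ C n : Set X)).ncard : ℝ≥0∞) ≤ K * ∏ x ∈ P, W x)
    (Z : ι → X × X) :
    ∑ σ : ι → Bool, supWeight D C ε (swapAt σ Z) ≤
      2 ^ Fintype.card ι * (K * ∏ i, W (Z i).1 * W (Z i).2) := by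
  classical
  set P : Finset X := Finset.univ.image (fun i => (Z i).1) ∪ Finset.univ.image fun i => (Z i).2
    with hP
  have hP1 : ∀ i, (Z i).1 ∈ P := fun i => by simp [hP]
  have hP2 : ∀ i, (Z i).2 ∈ P := fun i => by simp [hP]
  have hfin : (Set.range fun n => (P ∩ C n : Set X)).Finite := by
    refine (P.finite_toSet.powerset).subset ?_
    rintro _ ⟨n, rfl⟩
    exact Set.inter_subset_left
  have hle : ∀ σ : ι → Bool, supWeight D C ε (swapAt σ Z) ≤
      ∑ c ∈ hfin.toFinset, ∏ i, pairWeight c (swapAt σ Z i) := by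
    intro σ
    refine iSup₂_le fun n _ => ?_
    have : ∏ i, pairWeight (C n) (swapAt σ Z i) =
        ∏ i, pairWeight (P ∩ C n : Set X) (swapAt σ Z i) := by
      refine Finset.prod_congr rfl fun i _ => pairWeight_congr ?_ ?_ <;>
        by_cases h : σ i <;> simp [swapAt, h, hP1, hP2]
    rw [this]
    exact Finset.single_le_sum (f := fun c => ∏ i, pairWeight c (swapAt σ Z i))
      (fun _ _ => zero_le) (by simp)
  -- Repeated points only enlarge the right side, because `W ≥ 1`.
  have hprod : ∏ x ∈ P, W x ≤ ∏ i, W (Z i).1 * W (Z i).2 := by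
    have himg : ∀ f : ι → X, ∏ x ∈ Finset.univ.image f, W x ≤ ∏ i, W (f i) := by
      intro f
      rw [Finset.prod_comp W f]
      refine Finset.prod_le_prod' fun x hx => ?_
      refine le_self_pow₀ (h1 x) ?_
      obtain ⟨i, -, rfl⟩ := Finset.mem_image.1 hx
      exact (Finset.card_pos.2 ⟨i, by simp⟩).ne'
    rw [Finset.prod_mul_distrib]
    refine le_trans ?_ (mul_le_mul' (himg fun i => (Z i).1) (himg fun i => (Z i).2))
    rw [← Finset.prod_union_inter]
    exact le_mul_of_one_le_right' (Finset.one_le_prod' fun x _ => h1 x)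
  calc ∑ σ : ι → Bool, supWeight D C ε (swapAt σ Z)
      ≤ ∑ σ : ι → Bool, ∑ c ∈ hfin.toFinset, ∏ i, pairWeight c (swapAt σ Z i) :=
        Finset.sum_le_sum fun σ _ => hle σ
    _ = ∑ c ∈ hfin.toFinset, ∑ σ : ι → Bool, ∏ i, pairWeight c (swapAt σ Z i) :=
        Finset.sum_comm
    _ ≤ ∑ c ∈ hfin.toFinset, 2 ^ Fintype.card ι :=
        Finset.sum_le_sum fun c _ => sum_prod_pairWeight_le c Z
    _ = 2 ^ Fintype.card ι * ((Set.range fun n => (P ∩ C n : Set X)).ncard : ℝ≥0∞) := by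
        rw [Finset.sum_const, nsmul_eq_mul, mul_comm, Set.ncard_eq_toFinset_card _ hfin]
    _ ≤ _ := by
        gcongr
        exact (hK P).trans (by gcongr)

/-- An `ε`-net theorem: the probability that a sample misses one of the sets `C n` of measure more
than `ε`, in terms of a multiplicative bound for the number of traces of the sets. -/
theorem measure_exists_missed_mul_le {ι X : Type*} [Fintype ι] [MeasurableSpace X]
    (D : Measure X) [IsProbabilityMeasure D] {C : ℕ → Set X} (hC : ∀ n, MeasurableSet (C n))
    (ε : ℝ≥0∞) {W : X → ℝ≥0∞} (hW : Measurable W) (h1 : ∀ x, 1 ≤ W x) {K : ℝ≥0∞}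
    (hK : ∀ P : Finset X,
      ((Set.range fun n => (P ∩ C n : Set X)).ncard : ℝ≥0∞) ≤ K * ∏ x ∈ P, W x) :
    (Measure.pi fun _ : ι => D) {S | ∃ n, ε < D (C n) ∧ ∀ i, S i ∉ C n} *
        (1 + ε) ^ Fintype.card ι ≤ K * (∫⁻ x, W x ∂D) ^ (2 * Fintype.card ι) := by
  classical
  refine (measure_mul_le_lintegral_supWeight D hC ε).trans ?_
  have hF := measurable_supWeight (ι := ι) D hC ε
  set J := ∫⁻ Z, supWeight D C ε Z ∂(Measure.pi fun _ : ι => D.prod D) with hJ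
  -- Every swap preserves the product measure, so `J` equals its average over all swaps.
  have hsum : (2 : ℝ≥0∞) ^ Fintype.card ι * J =
      ∫⁻ Z, ∑ σ : ι → Bool, supWeight D C ε (swapAt σ Z) ∂(Measure.pi fun _ : ι => D.prod D) := by
    rw [lintegral_finsetSum (f := fun σ Z => supWeight D C ε (swapAt σ Z)) _
      fun σ _ => hF.comp (measurePreserving_swapAt D σ).measurable]
    have : ∀ σ : ι → Bool, ∫⁻ Z, supWeight D C ε (swapAt σ Z)
        ∂(Measure.pi fun _ : ι => D.prod D) = J := fun σ =>
      (measurePreserving_swapAt D σ).lintegral_comp hF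
    simp [this]
  have hWW : Measurable fun z : X × X => W z.1 * W z.2 := by fun_prop
  have hle : (2 : ℝ≥0∞) ^ Fintype.card ι * J ≤
      2 ^ Fintype.card ι * (K * (∫⁻ x, W x ∂D) ^ (2 * Fintype.card ι)) := by
    rw [hsum]
    refine (lintegral_mono fun Z => sum_supWeight_swapAt_le D ε h1 hK Z).trans ?_
    have hm : Measurable fun Z : ι → X × X => ∏ i, W (Z i).1 * W (Z i).2 := by fun_prop
    rw [lintegral_const_mul _ (hm.const_mul _), lintegral_const_mul _ hm,
      lintegral_pi_prod_eq_pow (f := fun z : X × X => W z.1 * W z.2) _ hWW,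
      lintegral_prod_mul hW.aemeasurable hW.aemeasurable, ← sq, ← pow_mul]
  exact (ENNReal.mul_le_mul_iff_right (by simp) (by simp)).1 hle

/-! ### Localization of the ε-net theorem -/

/-- A multiplicative form of the Sauer-Shelah bound for the number of traces of the sets `B n` on a
finite set, as it holds when the sets are unions of `N` slices of a class of VC dimension `d`. -/
def TraceBound {X : Type*} (B : ℕ → Set X) (N d : ℕ) : Prop :=
  ∀ r : ℝ, 0 < r → r ≤ 1 → ∀ P : Finset X,
    r ^ d * ((Set.range fun n => (P ∩ B n : Set X)).ncard : ℝ) ≤ (1 + r) ^ (N * P.card)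

/-- Points outside `E` do not distinguish the sets `B n ∩ E`, so only points of `E` pay the factor
`(1 + r) ^ N`. The mean of this weight is close to 1 when `E` is small. -/
theorem TraceBound.ncard_inter_le {X : Type*} {B : ℕ → Set X} {N d : ℕ} (hB : TraceBound B N d)
    {r : ℝ} (h0 : 0 < r) (h1 : r ≤ 1) (E : Set X) (P : Finset X) :
    ((Set.range fun n => (P ∩ (B n ∩ E) : Set X)).ncard : ℝ≥0∞) ≤
      ENNReal.ofReal ((r⁻¹) ^ d) *
        ∏ x ∈ P, (1 + E.indicator (fun _ => ENNReal.ofReal ((1 + r) ^ N - 1)) x) := by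
  classical
  have hN : 1 ≤ (1 + r) ^ N := one_le_pow₀ (by linarith)
  have h := hB r h0 h1 (P.filter (· ∈ E))
  have hset : ∀ n, (P ∩ (B n ∩ E) : Set X) = ((P.filter (· ∈ E) : Finset X) ∩ B n : Set X) := by
    intro n; ext x; simp; tauto
  simp_rw [hset]
  have hW : ∀ x, 1 + E.indicator (fun _ => ENNReal.ofReal ((1 + r) ^ N - 1)) x =
      if x ∈ E then ENNReal.ofReal ((1 + r) ^ N) else 1 := by
    intro x
    by_cases hx : x ∈ E
    · simp only [hx, Set.indicator_of_mem, if_true]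
      rw [← ENNReal.ofReal_one, ← ENNReal.ofReal_add zero_le_one (by linarith)]
      congr 1; ring
    · simp [hx]
  simp_rw [hW]
  rw [← Finset.prod_filter, Finset.prod_const, ← ENNReal.ofReal_pow (by positivity),
    ← ENNReal.ofReal_mul (by positivity), ← ENNReal.ofReal_natCast]
  refine ENNReal.ofReal_le_ofReal ?_
  rw [inv_pow, ← pow_mul, inv_mul_eq_div, le_div_iff₀ (by positivity), mul_comm]
  exact h

theorem exp_half_le_one_add {ε : ℝ} (h0 : 0 ≤ ε) (h1 : ε ≤ 1) : Real.exp (ε / 2) ≤ 1 + ε := by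
  have h := Real.abs_exp_sub_one_le (x := ε / 2) (by rw [abs_of_nonneg (by linarith)]; linarith)
  rw [abs_of_nonneg (by linarith : (0 : ℝ) ≤ ε / 2)] at h
  linarith [le_abs_self (Real.exp (ε / 2) - 1)]

theorem one_add_pow_sub_one_le {r : ℝ} {N : ℕ} (h0 : 0 ≤ r) (h1 : r * N ≤ 1) :
    (1 + r) ^ N - 1 ≤ 2 * (r * N) := by
  have h := Real.abs_exp_sub_one_le (x := r * N) (by rwa [abs_of_nonneg (by positivity)])
  rw [abs_of_nonneg (by positivity : 0 ≤ r * N)] at h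
  have h2 : (1 + r) ^ N ≤ Real.exp (r * N) := by
    rw [mul_comm, Real.exp_nat_mul]
    gcongr
    linarith [Real.add_one_le_exp r]
  linarith [le_abs_self (Real.exp (r * N) - 1)]

/-- The localized `ε`-net theorem: inside a set of measure at most `p`, consistent sets have measure
at most `ε`. -/
theorem measure_exists_consistent_inter_le {ι X : Type*} [Fintype ι] [MeasurableSpace X]
    (D : Measure X) [IsProbabilityMeasure D] {B : ℕ → Set X} (hBm : ∀ n, MeasurableSet (B n))
    {N d : ℕ} (hN : 0 < N) (hB : TraceBound B N d) {E : Set X} (hE : MeasurableSet E) {p ε : ℝ}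
    (hε : 0 < ε) (hε1 : ε ≤ 1) (hεp : ε ≤ p) (hp : D E ≤ ENNReal.ofReal p) :
    (Measure.pi fun _ : ι => D) {S | ∃ n, ENNReal.ofReal ε < D (B n ∩ E) ∧ ∀ i, S i ∉ B n} ≤
      ENNReal.ofReal ((16 * p * N / ε) ^ d * Real.exp (-(Fintype.card ι * ε / 4))) := by
  have hp0 : 0 < p := hε.trans_le hεp
  have hN0 : (0 : ℝ) < N := by exact_mod_cast hN
  have hN1 : (1 : ℝ) ≤ N := by exact_mod_cast hN
  set m := Fintype.card ι
  -- With this `r`, `(1 + r) ^ N - 1 ≤ 2rN = ε / (8p)`, so the mean weight is at most `1 + ε / 8`.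
  set r : ℝ := ε / (16 * p * N) with hr
  have hr0 : 0 < r := by positivity
  have hrN : r * N = ε / p / 16 := by rw [hr]; field_simp
  have hq : ε / p ≤ 1 := (div_le_one hp0).2 hεp
  have hr1 : r ≤ 1 := by
    have : r * 1 ≤ r * N := by gcongr
    linarith
  set a : ℝ := (1 + r) ^ N - 1 with ha
  have ha0 : 0 ≤ a := by
    have : 1 ≤ (1 + r) ^ N := one_le_pow₀ (by linarith)
    linarith
  have hap : a * p ≤ ε / 8 := by
    have h := one_add_pow_sub_one_le hr0.le (N := N) (by linarith)
    have : a * p ≤ 2 * (r * N) * p := by gcongr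
    rw [hrN] at this
    refine this.trans (le_of_eq ?_)
    field_simp; norm_num
  have key := measure_exists_missed_mul_le (ι := ι) D (C := fun n => B n ∩ E)
    (fun n => (hBm n).inter hE) (ENNReal.ofReal ε)
    (W := fun x => 1 + E.indicator (fun _ => ENNReal.ofReal a) x)
    (measurable_const.add (measurable_const.indicator hE)) (fun x => le_self_add)
    (K := ENNReal.ofReal ((r⁻¹) ^ d)) (hB.ncard_inter_le hr0 hr1 E)
  have hint : ∫⁻ x, (1 + E.indicator (fun _ => ENNReal.ofReal a) x) ∂D ≤
      ENNReal.ofReal (Real.exp (ε / 8)) := by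
    rw [lintegral_add_left measurable_const, lintegral_indicator_const hE]
    calc _ ≤ 1 + ENNReal.ofReal a * ENNReal.ofReal p := by simp; gcongr
      _ = ENNReal.ofReal (1 + a * p) := by
        rw [← ENNReal.ofReal_mul ha0, ← ENNReal.ofReal_one,
          ← ENNReal.ofReal_add zero_le_one (by positivity)]
      _ ≤ _ := ENNReal.ofReal_le_ofReal (by linarith [Real.add_one_le_exp (ε / 8)])
  -- The gain `(1 + ε) ^ m ≥ exp (mε/2)` beats the cost `exp (ε/8) ^ (2m) = exp (mε/4)` of the
  -- doubled sample.
  set U : Set (ι → X) := {S | ∃ n, ENNReal.ofReal ε < D (B n ∩ E) ∧ ∀ i, S i ∉ B n}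
  have hle : (Measure.pi fun _ : ι => D) U * ENNReal.ofReal (Real.exp (m * (ε / 2))) ≤
      ENNReal.ofReal ((16 * p * N / ε) ^ d * Real.exp (-(m * ε / 4))) *
        ENNReal.ofReal (Real.exp (m * (ε / 2))) := by
    calc (Measure.pi fun _ : ι => D) U * ENNReal.ofReal (Real.exp (m * (ε / 2)))
        ≤ (Measure.pi fun _ : ι => D)
            {S | ∃ n, ENNReal.ofReal ε < D (B n ∩ E) ∧ ∀ i, S i ∉ B n ∩ E} *
            (1 + ENNReal.ofReal ε) ^ m := by
          gcongr
          · exact fun S ⟨n, hn, hS⟩ => ⟨n, hn, fun i hi => hS i hi.1⟩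
          · rw [Real.exp_nat_mul, ← ENNReal.ofReal_one, ← ENNReal.ofReal_add zero_le_one hε.le,
              ← ENNReal.ofReal_pow (by positivity)]
            refine ENNReal.ofReal_le_ofReal ?_
            gcongr
            exact exp_half_le_one_add hε.le hε1
      _ ≤ ENNReal.ofReal ((r⁻¹) ^ d) *
            (∫⁻ x, (1 + E.indicator (fun _ => ENNReal.ofReal a) x) ∂D) ^ (2 * m) := key
      _ ≤ ENNReal.ofReal ((r⁻¹) ^ d) * ENNReal.ofReal (Real.exp (ε / 8)) ^ (2 * m) := by gcongr
      _ = _ := by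
          rw [← ENNReal.ofReal_pow (by positivity), ← ENNReal.ofReal_mul (by positivity),
            ← ENNReal.ofReal_mul (by positivity), ← Real.exp_nat_mul, hr, inv_div, mul_assoc (_ ^ d),
            ← Real.exp_add]
          congr 3
          push_cast; ring
  exact (ENNReal.mul_le_mul_iff_left (by simp [Real.exp_pos]) (by simp)).1 hle

/-- The localized `ε`-net theorem for a region that is determined by the part of the sample outside
the block `F`. -/
theorem measure_exists_consistent_block_le {ι X : Type*} [Fintype ι] [DecidableEq ι]
    [MeasurableSpace X] (D : Measure X) [IsProbabilityMeasure D] {B : ℕ → Set X}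
    (hBm : ∀ n, MeasurableSet (B n)) {N d : ℕ} (hN : 0 < N) (hB : TraceBound B N d)
    (F : Finset ι) {E : (ι → X) → Set X} (hEm : MeasurableSet {q : (ι → X) × X | q.2 ∈ E q.1})
    (hE : ∀ S S' : ι → X, (∀ i ∉ F, S i = S' i) → E S = E S') {p ε : ℝ}
    (hε : 0 < ε) (hε1 : ε ≤ 1) (hεp : ε ≤ p) :
    (Measure.pi fun _ : ι => D) {S | D (E S) ≤ ENNReal.ofReal p ∧
        ∃ n, ENNReal.ofReal ε < D (B n ∩ E S) ∧ ∀ i ∈ F, S i ∉ B n} ≤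
      ENNReal.ofReal ((16 * p * N / ε) ^ d * Real.exp (-(F.card * ε / 4))) := by
  set U : Set (ι → X) := {S | D (E S) ≤ ENNReal.ofReal p ∧
        ∃ n, ENNReal.ofReal ε < D (B n ∩ E S) ∧ ∀ i ∈ F, S i ∉ B n} with hU
  have hm1 : Measurable fun S => D (E S) := measurable_measure_prodMk_left hEm
  have hm2 : ∀ n, Measurable fun S => D (B n ∩ E S) := fun n =>
    measurable_measure_prodMk_left (s := {q : (ι → X) × X | q.2 ∈ B n} ∩ {q | q.2 ∈ E q.1})
      (((hBm n).preimage measurable_snd).inter hEm)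
  have hUm : MeasurableSet U := by
    have : U = {S | D (E S) ≤ ENNReal.ofReal p} ∩ ⋃ n, ({S | ENNReal.ofReal ε < D (B n ∩ E S)} ∩
        ⋂ i ∈ F, (fun S : ι → X => S i) ⁻¹' (B n)ᶜ) := by
      ext S; simp [hU]
    rw [this]
    refine (measurableSet_le hm1 measurable_const).inter (MeasurableSet.iUnion fun n =>
      (measurableSet_lt measurable_const (hm2 n)).inter (MeasurableSet.iInter fun i =>
        MeasurableSet.iInter fun _ => (hBm n).compl.preimage (measurable_pi_apply i)))
  have e := (measurePreserving_piEquivPiSubtypeProd (fun _ : ι => D) (· ∈ F)).symm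
  rw [← e.measure_preimage hUm.nullMeasurableSet, Measure.prod_apply_symm
    (hUm.preimage e.measurable)]
  refine (lintegral_mono (g := fun _ => ENNReal.ofReal ((16 * p * N / ε) ^ d *
    Real.exp (-(F.card * ε / 4)))) fun b => ?_).trans (by simp)
  obtain h | ⟨a₀, ha₀⟩ := Set.eq_empty_or_nonempty ((fun a => (a, b)) ⁻¹'
    ((MeasurableEquiv.piEquivPiSubtypeProd (fun _ : ι => X) (· ∈ F)).symm ⁻¹' U))
  · rw [h, measure_empty]
    exact zero_le
  set S₀ := (MeasurableEquiv.piEquivPiSubtypeProd (fun _ : ι => X) (· ∈ F)).symm (a₀, b)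
  have hS₀ : S₀ ∈ U := ha₀
  have hEeq : ∀ a, E ((MeasurableEquiv.piEquivPiSubtypeProd (fun _ : ι => X) (· ∈ F)).symm (a, b))
      = E S₀ := by
    intro a
    refine hE _ _ fun i hi => ?_
    simp [S₀, MeasurableEquiv.piEquivPiSubtypeProd, Equiv.piEquivPiSubtypeProd, hi]
  have hES : MeasurableSet (E S₀) := measurable_prodMk_left hEm
  have key := @measure_exists_consistent_inter_le {i // i ∈ F} X (Subtype.fintype _) _ D _ B hBm N d
    hN hB _ hES p ε hε hε1 hεp hS₀.1
  rw [@Fintype.card_of_subtype ι (· ∈ F) F (fun _ => Iff.rfl) (Subtype.fintype _)] at key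
  refine (measure_mono ?_).trans key
  rintro a ⟨-, n, hn, ha⟩
  rw [hEeq] at hn
  refine ⟨n, hn, fun i => ?_⟩
  have := ha i i.2
  simpa [MeasurableEquiv.piEquivPiSubtypeProd, Equiv.piEquivPiSubtypeProd] using this

/-! ### Recursive subsampling and majority votes -/

/-- The first index `n` for which no point of the subsample `A` lies in `b n`. -/
noncomputable def firstConsistent {ι Y : Type*} (b : ℕ → Set Y) (S : ι → Y) (A : Finset ι) : ℕ :=
  sInf {n | ∀ i ∈ A, S i ∉ b n}

/-- Given the blocks `c s j` of the sample, the training set that is obtained from `A` by adding all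
blocks of level `s` but the `i`-th. -/
def addBlocks {ι : Type*} [DecidableEq ι] (c : ℕ → Fin 3 → Finset ι) (s : ℕ) (A : Finset ι)
    (i : Fin 3) : Finset ι :=
  A ∪ (Finset.univ.erase i).biUnion (c s)

/-- Among the `3 ^ s` hypotheses that recursive subsampling trains on the blocks of level below `s`
and the common set `A`, the number of those that err at `x`. -/
noncomputable def errCount {ι X : Type*} [DecidableEq ι] (B : ℕ → Set X)
    (c : ℕ → Fin 3 → Finset ι) : ℕ → Finset ι → (ι → X) → X → ℕ
  | 0, A, S, x => (B (firstConsistent B S A)).indicator 1 x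
  | s + 1, A, S, x => ∑ i, errCount B c s (addBlocks c s A i) S x

/-- The region where the majority of the hypotheses errs. -/
def majorityError {ι X : Type*} [DecidableEq ι] (B : ℕ → Set X) (c : ℕ → Fin 3 → Finset ι)
    (s : ℕ) (A : Finset ι) (S : ι → X) : Set X :=
  {x | 3 ^ s ≤ 2 * errCount B c s A S x}

theorem firstConsistent_notMem {ι Y : Type*} {b : ℕ → Set Y} {S : ι → Y} {A : Finset ι}
    (h : ∃ n, ∀ i ∈ A, S i ∉ b n) : ∀ i ∈ A, S i ∉ b (firstConsistent b S A) :=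
  Nat.sInf_mem h

theorem measurable_firstConsistent {ι X : Type*} [MeasurableSpace X] {B : ℕ → Set X}
    (hB : ∀ n, MeasurableSet (B n))
    (hcons : ∀ (S : ι → X) (A : Finset ι), ∃ n, ∀ i ∈ A, S i ∉ B n) (A : Finset ι) :
    Measurable fun S : ι → X => firstConsistent B S A := by
  classical
  have : (fun S : ι → X => firstConsistent B S A) = fun S => Nat.find (hcons S A) := by
    funext S
    exact le_antisymm (Nat.sInf_le (Nat.find_spec (hcons S A)))
      (Nat.find_min' _ (firstConsistent_notMem (hcons S A)))
  rw [this]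
  refine measurable_find _ fun n => ?_
  have : {S : ι → X | ∀ i ∈ A, S i ∉ B n} = ⋂ i ∈ A, (fun S : ι → X => S i) ⁻¹' (B n)ᶜ := by
    ext S; simp
  rw [this]
  exact Finset.measurableSet_biInter _ fun i _ =>
    (hB n).compl.preimage (measurable_pi_apply i)

section Count

variable {ι X : Type*} [DecidableEq ι] (B : ℕ → Set X) (c : ℕ → Fin 3 → Finset ι)

theorem errCount_le (s : ℕ) (A : Finset ι) (S : ι → X) (x : X) : errCount B c s A S x ≤ 3 ^ s := by
  induction s generalizing A with
  | zero =>
    by_cases h : x ∈ B (firstConsistent B S A) <;> simp [errCount, h]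
  | succ s ih =>
    calc errCount B c (s + 1) A S x ≤ ∑ _i : Fin 3, 3 ^ s := Finset.sum_le_sum fun i _ => ih _
      _ = 3 ^ (s + 1) := by simp [pow_succ']

/-- Source of independence: the vote depends only on `A` and the blocks below level `s`, so a block
of level `s` disjoint from these is fresh for it. -/
theorem errCount_congr (s : ℕ) (A : Finset ι) {S S' : ι → X} (hA : ∀ i ∈ A, S i = S' i)
    (hc : ∀ s' < s, ∀ j, ∀ i ∈ c s' j, S i = S' i) (x : X) :
    errCount B c s A S x = errCount B c s A S' x := by
  induction s generalizing A with
  | zero =>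
    have : firstConsistent B S A = firstConsistent B S' A := by
      unfold firstConsistent
      congr 1
      ext n
      exact forall₂_congr fun i hi => by rw [hA i hi]
    simp [errCount, this]
  | succ s ih =>
    refine Finset.sum_congr rfl fun i _ => ih _ ?_ fun s' hs' => hc s' (by omega)
    intro k hk
    rcases Finset.mem_union.1 hk with hk | hk
    · exact hA k hk
    · obtain ⟨j, -, hj⟩ := Finset.mem_biUnion.1 hk
      exact hc s (by omega) j k hj

variable {B}

theorem measurable_errCount [MeasurableSpace X] (hB : ∀ n, MeasurableSet (B n))
    (hcons : ∀ (S : ι → X) (A : Finset ι), ∃ n, ∀ i ∈ A, S i ∉ B n) (s : ℕ) (A : Finset ι) :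
    Measurable fun q : (ι → X) × X => errCount B c s A q.1 q.2 := by
  induction s generalizing A with
  | zero =>
    have hset : MeasurableSet {q : (ι → X) × X | q.2 ∈ B (firstConsistent B q.1 A)} := by
      have : {q : (ι → X) × X | q.2 ∈ B (firstConsistent B q.1 A)} =
          ⋃ n, ({q | firstConsistent B q.1 A = n} ∩ {q | q.2 ∈ B n}) := by
        ext q; simp
      rw [this]
      refine MeasurableSet.iUnion fun n => MeasurableSet.inter ?_ ((hB n).preimage measurable_snd)
      exact ((measurable_firstConsistent hB hcons A).comp measurable_fst)
        (measurableSet_singleton n)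
    exact measurable_one.indicator hset
  | succ s ih =>
    exact Finset.measurable_sum _ fun i _ => ih _

theorem measurableSet_majorityError [MeasurableSpace X] (hB : ∀ n, MeasurableSet (B n))
    (hcons : ∀ (S : ι → X) (A : Finset ι), ∃ n, ∀ i ∈ A, S i ∉ B n) (s : ℕ) (A : Finset ι) :
    MeasurableSet {q : (ι → X) × X | q.2 ∈ majorityError B c s A q.1} :=
  measurableSet_le measurable_const ((measurable_errCount c hB hcons s A).const_mul 2)

variable {c}

/-- Where the majority over all three groups errs, the majority of one group errs together with a
fixed fraction of the hypotheses of the two other groups. -/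
theorem majorityError_succ_subset (s : ℕ) (A : Finset ι) (S : ι → X) :
    majorityError B c (s + 1) A S ⊆ ⋃ i, (majorityError B c s (addBlocks c s A i) S ∩
      {x | 3 ^ s ≤ 2 * ∑ j ∈ Finset.univ.erase i, errCount B c s (addBlocks c s A j) S x}) := by
  intro x hx
  have hx' : 3 ^ (s + 1) ≤ 2 * ∑ i, errCount B c s (addBlocks c s A i) S x := hx
  have hle := fun i => errCount_le B c s (addBlocks c s A i) S x
  have hsum := fun i => Finset.add_sum_erase Finset.univ
    (fun j => errCount B c s (addBlocks c s A j) S x) (Finset.mem_univ i)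
  -- Pigeonhole over the three groups. Group `i` accounts for at most `3 ^ s` errors, so twice the
  -- errors of the other two is at least `3 ^ (s + 1) - 2 * 3 ^ s = 3 ^ s`.
  obtain ⟨i, hi⟩ : ∃ i, 3 ^ s ≤ 2 * errCount B c s (addBlocks c s A i) S x := by
    by_contra! h
    have h0 := h 0
    have h1 := h 1
    have h2 := h 2
    rw [Fin.sum_univ_three, pow_succ] at hx'
    omega
  refine Set.mem_iUnion.2 ⟨i, hi, ?_⟩
  have h1 := hsum i
  have h2 := hle i
  rw [← h1, pow_succ] at hx'
  simp only [Set.mem_ofPred_eq]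
  omega

variable [MeasurableSpace X] (D : Measure X)

/-- If all sets consistent with the block `F` have small measure inside `E`, then so do, on average,
the hypotheses that are trained on `F`. -/
theorem setLIntegral_errCount_le (hB : ∀ n, MeasurableSet (B n))
    (hcons : ∀ (S : ι → X) (A : Finset ι), ∃ n, ∀ i ∈ A, S i ∉ B n) {S : ι → X} {F : Finset ι}
    {E : Set X} {ε : ℝ≥0∞} (hF : ∀ n, (∀ i ∈ F, S i ∉ B n) → D (B n ∩ E) ≤ ε)
    (s : ℕ) {A : Finset ι} (hA : F ⊆ A) :
    ∫⁻ x in E, (errCount B c s A S x : ℝ≥0∞) ∂D ≤ 3 ^ s * ε := by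
  induction s generalizing A with
  | zero =>
    have h : ∀ x, (errCount B c 0 A S x : ℝ≥0∞) = (B (firstConsistent B S A)).indicator 1 x := by
      intro x
      by_cases h : x ∈ B (firstConsistent B S A) <;> simp [errCount, h]
    simp_rw [h]
    rw [lintegral_indicator_one (hB _), Measure.restrict_apply (hB _), pow_zero, one_mul]
    exact hF _ fun i hi => firstConsistent_notMem (hcons S A) i (hA hi)
  | succ s ih =>
    have hm : ∀ i, Measurable fun x => (errCount B c s (addBlocks c s A i) S x : ℝ≥0∞) := fun i =>
      (measurable_of_countable (fun n : ℕ => (n : ℝ≥0∞))).comp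
        ((measurable_errCount c hB hcons s _).comp measurable_prodMk_left)
    simp only [errCount, Nat.cast_sum]
    rw [lintegral_finsetSum _ fun i _ => hm i]
    calc _ ≤ ∑ _i : Fin 3, 3 ^ s * ε :=
          Finset.sum_le_sum fun i _ => ih (hA.trans Finset.subset_union_left)
      _ = 3 ^ (s + 1) * ε := by simp [pow_succ', mul_assoc]

/-- Groups `j ≠ i` are trained on block `i`, so inside the error region of group `i` their
hypotheses have measure at most `ε` each. Markov's inequality turns this average into `4 * ε`, and
there are three choices of `i`. -/
theorem measure_majorityError_succ_le (hB : ∀ n, MeasurableSet (B n))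
    (hcons : ∀ (S : ι → X) (A : Finset ι), ∃ n, ∀ i ∈ A, S i ∉ B n) (S : ι → X) (s : ℕ)
    (A : Finset ι) {ε : ℝ≥0∞}
    (h : ∀ i n, (∀ k ∈ c s i, S k ∉ B n) →
      D (B n ∩ majorityError B c s (addBlocks c s A i) S) ≤ ε) :
    D (majorityError B c (s + 1) A S) ≤ 12 * ε := by
  have hm : ∀ i, Measurable fun x => (errCount B c s (addBlocks c s A i) S x : ℝ≥0∞) := fun i =>
    (measurable_of_countable (fun n : ℕ => (n : ℝ≥0∞))).comp
      ((measurable_errCount c hB hcons s _).comp measurable_prodMk_left)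
  have hi : ∀ i, D (majorityError B c s (addBlocks c s A i) S ∩
      {x | 3 ^ s ≤ 2 * ∑ j ∈ Finset.univ.erase i, errCount B c s (addBlocks c s A j) S x}) ≤
      4 * ε := by
    intro i
    set E := majorityError B c s (addBlocks c s A i) S
    set f : X → ℝ≥0∞ := fun x =>
      2 * ∑ j ∈ Finset.univ.erase i, (errCount B c s (addBlocks c s A j) S x : ℝ≥0∞) with hf
    have hfm : Measurable f := (Finset.measurable_sum _ fun j _ => hm j).const_mul 2
    have hset : {x | 3 ^ s ≤ 2 * ∑ j ∈ Finset.univ.erase i,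
        errCount B c s (addBlocks c s A j) S x} = {x | (3 ^ s : ℝ≥0∞) ≤ f x} := by
      ext x
      simp only [Set.mem_ofPred_eq, hf]
      exact_mod_cast Iff.rfl
    have hmeas : MeasurableSet {x | (3 ^ s : ℝ≥0∞) ≤ f x} := measurableSet_le measurable_const hfm
    have hmarkov := mul_meas_ge_le_lintegral (μ := D.restrict E) hfm (3 ^ s)
    rw [Measure.restrict_apply hmeas, Set.inter_comm] at hmarkov
    rw [hset]
    have hint : ∫⁻ x in E, f x ∂D ≤ 3 ^ s * (4 * ε) := by
      simp only [hf]
      rw [lintegral_const_mul _ (Finset.measurable_sum _ fun j _ => hm j),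
        lintegral_finsetSum _ fun j _ => hm j]
      calc _ ≤ 2 * ∑ _j ∈ Finset.univ.erase i, 3 ^ s * ε := by
            gcongr with j hj
            refine setLIntegral_errCount_le D hB hcons (F := c s i) (h i) s ?_
            refine subset_trans ?_ Finset.subset_union_right
            exact Finset.subset_biUnion_of_mem (c s)
              (Finset.mem_erase.2 ⟨(Finset.ne_of_mem_erase hj).symm, Finset.mem_univ _⟩)
        _ = 3 ^ s * (4 * ε) := by
            simp
            ring
    exact (ENNReal.mul_le_mul_iff_right (by simp) (by simp)).1 (hmarkov.trans hint)
  calc D (majorityError B c (s + 1) A S) ≤ _ := measure_mono (majorityError_succ_subset s A S)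
    _ ≤ _ := measure_iUnion_fintype_le _ _
    _ ≤ ∑ _i : Fin 3, 4 * ε := Finset.sum_le_sum fun i _ => hi i
    _ = 12 * ε := by simp; ring

end Count

/-! ### The induction over levels -/

theorem log_six_le : Real.log 6 ≤ 3 * Real.log 2 := by
  rw [show (3 : ℝ) * Real.log 2 = Real.log (2 ^ 3) by rw [Real.log_pow]; norm_num]
  exact Real.log_le_log (by norm_num) (by norm_num)

theorem log_mul_le {a : ℕ} {c q : ℝ} (hc0 : 0 < c) (hc : c ≤ 2 ^ a) (hq : 2 ≤ q) :
    Real.log (c * q) ≤ (a + 1) * Real.log q := by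
  have hq0 : 0 < q := by linarith
  calc Real.log (c * q) ≤ Real.log (q ^ a * q) := by
        refine Real.log_le_log (by positivity) ?_
        gcongr
        exact hc.trans (by gcongr)
    _ = (a + 1) * Real.log q := by
        rw [← pow_succ, Real.log_pow]; push_cast; ring

/-- The numerical estimate for one round of recursive subsampling. -/
theorem subsampling_bound {N d M : ℕ} (hN : 2 ≤ N) (hd : 1 ≤ d) {δ L : ℝ} (hδ : 0 < δ)
    (hδ1 : δ < 1) (hL : L = d * Real.log N + Real.log (1 / δ)) {R : ℝ} (hR : 0 < R) (hM : R ≤ M) :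
    (16 * (3072 / R * (d * Real.log N + Real.log (1 / (δ / 6)))) * N / (3072 / (4 * R) * L / 12))
        ^ d * Real.exp (-(M * (3072 / (4 * R) * L / 12) / 4)) ≤ δ / 6 := by
  have hN2 : (2 : ℝ) ≤ N := by exact_mod_cast hN
  have hd1 : (1 : ℝ) ≤ d := by exact_mod_cast hd
  have hlog2 : 0 < Real.log 2 := Real.log_pos (by norm_num)
  have hlogN : Real.log 2 ≤ Real.log N := Real.log_le_log (by norm_num) hN2
  have hV : Real.log 2 ≤ d * Real.log N := by nlinarith
  have hlδ : 0 < Real.log (1 / δ) := Real.log_pos (by rw [lt_div_iff₀ hδ]; linarith)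
  have hlδ' : Real.log (1 / (δ / 6)) = Real.log (1 / δ) + Real.log 6 := by
    rw [← Real.log_mul (by positivity) (by norm_num)]
    congr 1; field_simp
  have hL0 : 0 < L := by linarith
  have h6 := log_six_le
  -- The constant 3072 reproduces itself: `p / ε ≤ 192` and `16 * 192 = 3072`. Since `log 6 ≤ 3L`,
  -- passing to `δ / 6` costs only a constant factor and does not accumulate over levels.
  have hratio : 16 * (3072 / R * (d * Real.log N + Real.log (1 / (δ / 6)))) * N /
      (3072 / (4 * R) * L / 12) ≤ 3072 * N := by
    rw [div_le_iff₀ (by positivity), hlδ']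
    have : d * Real.log N + (Real.log (1 / δ) + Real.log 6) ≤ 4 * L := by linarith
    calc 16 * (3072 / R * (d * Real.log N + (Real.log (1 / δ) + Real.log 6))) * N
        ≤ 16 * (3072 / R * (4 * L)) * N := by gcongr
      _ = 3072 * N * (3072 / (4 * R) * L / 12) := by field_simp; norm_num
  have hlow : 16 * L ≤ M * (3072 / (4 * R) * L / 12) / 4 := by
    calc 16 * L = R * (3072 / (4 * R) * L / 12) / 4 := by field_simp; norm_num
      _ ≤ _ := by gcongr
  have hnum : 0 < d * Real.log N + Real.log (1 / (δ / 6)) := by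
    rw [hlδ']
    have : 0 < Real.log 6 := Real.log_pos (by norm_num)
    linarith
  calc _ ≤ (3072 * (N : ℝ)) ^ d * Real.exp (-(16 * L)) := by gcongr
    _ = Real.exp (d * Real.log (3072 * N) - 16 * L) := by
        rw [sub_eq_add_neg, Real.exp_add, Real.exp_nat_mul, Real.exp_log (by positivity)]
    _ ≤ Real.exp (Real.log (δ / 6)) := by
        refine Real.exp_le_exp.2 ?_
        -- Of the exponent `16 * L`, `13 * d * log N` pays for the power, and the remaining `3 * d *
        -- log N ≥ 3 * log 2` pays for `log 6`.
        have h1 := log_mul_le (a := 12) (c := 3072) (by norm_num) (by norm_num) hN2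
        have h2 : d * Real.log (3072 * N) ≤ 13 * (d * Real.log N) := by
          calc (d : ℝ) * Real.log (3072 * N) ≤ d * ((12 + 1) * Real.log N) := by
                gcongr; exact_mod_cast h1
            _ = 13 * (d * Real.log N) := by ring
        have h3 : Real.log (δ / 6) = -(Real.log (1 / δ) + Real.log 6) := by
          rw [← hlδ', one_div, Real.log_inv, neg_neg]
        rw [h3]
        linarith
    _ = δ / 6 := Real.exp_log (by positivity)

/-- Recursive subsampling: with high probability the majority vote over the hypotheses that are
trained on the blocks of level below `s` has an error of order `4 ^ (-s)`. -/
theorem measure_majorityError_gt_le {ι X : Type*} [Fintype ι] [DecidableEq ι] [MeasurableSpace X]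
    (D : Measure X) [IsProbabilityMeasure D] {B : ℕ → Set X} (hBm : ∀ n, MeasurableSet (B n))
    {N d : ℕ} (hN : 2 ≤ N) (hd : 1 ≤ d) (hB : TraceBound B N d)
    (hcons : ∀ (S : ι → X) (A : Finset ι), ∃ n, ∀ i ∈ A, S i ∉ B n)
    {c : ℕ → Fin 3 → Finset ι}
    (hdisj : ∀ s i s' j, (s, i) ≠ (s', j) → Disjoint (c s i) (c s' j)) {t : ℕ}
    (hcard : ∀ s < t, ∀ j, 4 ^ s ≤ (c s j).card) :
    ∀ s ≤ t, ∀ A : Finset ι, (∀ s' < s, ∀ j, Disjoint A (c s' j)) → ∀ δ : ℝ, 0 < δ → δ < 1 →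
      (Measure.pi fun _ : ι => D) {S | ENNReal.ofReal (3072 / 4 ^ s *
        (d * Real.log N + Real.log (1 / δ))) < D (majorityError B c s A S)} ≤
        ENNReal.ofReal δ := by
  have hN2 : (2 : ℝ) ≤ N := by exact_mod_cast hN
  have hd1 : (1 : ℝ) ≤ d := by exact_mod_cast hd
  have hlog2 : 0.6931471803 < Real.log 2 := Real.log_two_gt_d9
  have hlogN : Real.log 2 ≤ Real.log N := Real.log_le_log (by norm_num) hN2
  have hV : Real.log 2 ≤ d * Real.log N := by nlinarith
  have htriv : ∀ (s : ℕ) (A : Finset ι) (x δ : ℝ), 1 ≤ x →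
      (Measure.pi fun _ : ι => D) {S | ENNReal.ofReal x < D (majorityError B c s A S)} ≤
        ENNReal.ofReal δ := by
    intro s A x δ hx
    refine le_of_eq_of_le ?_ zero_le
    refine measure_mono_null (t := ∅) (fun S hS => ?_) measure_empty
    exact absurd (hS.trans_le prob_le_one) (by simpa using hx)
  intro s
  induction s with
  | zero =>
    intro _ A _ δ hδ hδ1
    refine htriv _ _ _ _ ?_
    have : 0 < Real.log (1 / δ) := Real.log_pos (by rw [lt_div_iff₀ hδ]; linarith)
    simp only [pow_zero, div_one]
    linarith
  | succ s ih =>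
    intro hs A hA δ hδ hδ1
    have hlδ : 0 < Real.log (1 / δ) := Real.log_pos (by rw [lt_div_iff₀ hδ]; linarith)
    set L := d * Real.log N + Real.log (1 / δ) with hL
    have hL0 : 0 < L := by linarith
    -- A bound of at least 1 is vacuous for a probability measure; otherwise `12 * ε < 1`, as the
    -- ε-net theorem needs `ε ≤ 1`.
    obtain hbig | hsmall := le_or_gt 1 (3072 / 4 ^ (s + 1) * L)
    · exact htriv _ _ _ _ hbig
    set ε := 3072 / (4 * 4 ^ s) * L / 12 with hε
    set p := 3072 / 4 ^ s * (d * Real.log N + Real.log (1 / (δ / 6))) with hp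
    have hε12 : 3072 / 4 ^ (s + 1) * L = 12 * ε := by rw [hε, pow_succ']; ring
    have hε0 : 0 < ε := by positivity
    have hεp : ε ≤ p := by
      have hmono : Real.log (1 / δ) ≤ Real.log (1 / (δ / 6)) := by
        refine Real.log_le_log (by positivity) ?_
        gcongr
        linarith
      have : 3072 / (4 * 4 ^ s) * L / 12 = 3072 / 4 ^ s * (L / 48) := by field_simp; norm_num
      rw [hε, hp, this]
      gcongr
      linarith
    have hdA : ∀ i, ∀ s' < s, ∀ j, Disjoint (addBlocks c s A i) (c s' j) := by
      intro i s' hs' j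
      refine Finset.disjoint_union_left.2 ⟨hA s' (by omega) j, ?_⟩
      refine (Finset.disjoint_biUnion_left _ _ _).2 fun k _ => hdisj _ _ _ _ ?_
      simp only [ne_eq, Prod.mk.injEq, not_and]
      omega
    have hbad : ∀ i, (Measure.pi fun _ : ι => D) {S | ENNReal.ofReal p <
        D (majorityError B c s (addBlocks c s A i) S)} ≤ ENNReal.ofReal (δ / 6) := fun i =>
      ih (by omega) _ (hdA i) (δ / 6) (by positivity) (by linarith)
    have hnet : ∀ i, (Measure.pi fun _ : ι => D) {S |
        D (majorityError B c s (addBlocks c s A i) S) ≤ ENNReal.ofReal p ∧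
        ∃ n, ENNReal.ofReal ε < D (B n ∩ majorityError B c s (addBlocks c s A i) S) ∧
          ∀ k ∈ c s i, S k ∉ B n} ≤ ENNReal.ofReal (δ / 6) := by
      intro i
      refine (measure_exists_consistent_block_le D hBm (by omega) hB (c s i)
        (measurableSet_majorityError c hBm hcons s (addBlocks c s A i)) ?_ hε0
        (by linarith) hεp).trans (ENNReal.ofReal_le_ofReal ?_)
      · intro S S' hSS
        unfold majorityError
        ext x
        rw [Set.mem_ofPred_eq, Set.mem_ofPred_eq, errCount_congr B c s _ _ _ x]
        · intro k hk
          refine hSS k fun hk' => ?_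
          rcases Finset.mem_union.1 hk with hk | hk
          · exact Finset.disjoint_left.1 (hA s (by omega) i) hk hk'
          · obtain ⟨j, hj, hkj⟩ := Finset.mem_biUnion.1 hk
            exact Finset.disjoint_left.1 (hdisj s j s i (by simpa using hj)) hkj hk'
        · intro s' hs' j k hk
          refine hSS k fun hk' => ?_
          refine Finset.disjoint_left.1 (hdisj s' j s i ?_) hk hk'
          simp only [ne_eq, Prod.mk.injEq, not_and]
          omega
      · exact subsampling_bound hN hd hδ hδ1 hL (by positivity)
          (by exact_mod_cast hcard s (by omega) i)
    have hsub : {S | ENNReal.ofReal (3072 / 4 ^ (s + 1) * L) < D (majorityError B c (s + 1) A S)} ⊆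
        ⋃ i, ({S | ENNReal.ofReal p < D (majorityError B c s (addBlocks c s A i) S)} ∪
          {S | D (majorityError B c s (addBlocks c s A i) S) ≤ ENNReal.ofReal p ∧
            ∃ n, ENNReal.ofReal ε < D (B n ∩ majorityError B c s (addBlocks c s A i) S) ∧
              ∀ k ∈ c s i, S k ∉ B n}) := by
      intro S hS
      by_contra hno
      simp only [Set.mem_iUnion, Set.mem_union, Set.mem_ofPred_eq, not_exists, not_or, not_and,
        not_lt] at hno
      have hS' : ENNReal.ofReal (3072 / 4 ^ (s + 1) * L) < D (majorityError B c (s + 1) A S) := hS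
      refine absurd hS' (not_lt.2 ?_)
      rw [hε12, ENNReal.ofReal_mul (by norm_num), ENNReal.ofReal_ofNat]
      refine measure_majorityError_succ_le D hBm hcons S s A fun i n hn => ?_
      by_contra hlt
      exact (hno i).2 (hno i).1 n (not_le.1 hlt) hn
    calc _ ≤ _ := measure_mono hsub
      _ ≤ _ := measure_iUnion_fintype_le _ _
      -- Six failure events: for each group, a region that is too large or a block that fails as a
      -- net.
      _ ≤ ∑ _i : Fin 3, (ENNReal.ofReal (δ / 6) + ENNReal.ofReal (δ / 6)) :=
          Finset.sum_le_sum fun i _ => (measure_union_le _ _).trans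
            (add_le_add (hbad i) (hnet i))
      _ = ENNReal.ofReal δ := by
          rw [← ENNReal.ofReal_add (by positivity) (by positivity), Finset.sum_const, nsmul_eq_mul,
            Finset.card_univ, Fintype.card_fin, ← ENNReal.ofReal_natCast,
            ← ENNReal.ofReal_mul (by positivity)]
          congr 1
          push_cast; ring

/-! ### Error sets of verifiers and their traces -/

section Verifiers

variable {X : Type u} {Step : Type v}

/-- The verifier `h` errs on some augmented example of the problem `x` with gold-standard traces
`G`. -/
def Errs (T : ℕ) (h : Verifier X Step) (x : X) (G : Set (List Step)) : Prop :=
  ∃ τ ∈ augmented T G, ¬ (h x τ = true ↔ τ ∈ goldTree G)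

theorem take_succ_mem_augmented {T : ℕ} {G : Set (List Step)} {τ : List Step} {j : ℕ}
    (hj : j < τ.length) (hT : j < T) (h : τ.take j ∈ goldTree G) :
    τ.take (j + 1) ∈ augmented T G :=
  ⟨τ.take j, τ[j], h, by simp; omega, by simp⟩

theorem ne_nil_of_mem_augmented {T : ℕ} {G : Set (List Step)} {τ : List Step}
    (h : τ ∈ augmented T G) : τ ≠ [] := by
  obtain ⟨p, s, -, -, rfl⟩ := h
  simp

/-- A verifier that is correct on all augmented examples is complete and sound. -/
theorem oneComplete_and_sound_of_not_errs {T : ℕ} (hT : 1 ≤ T) {h : Verifier X Step} {x : X}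
    {G : Set (List Step)} (hG : ∀ ρ ∈ G, ρ.length = T) (he : ¬ Errs T h x G) :
    OneComplete T h x G ∧ Sound T h x G := by
  have hc : ∀ τ ∈ augmented T G, (h x τ = true ↔ τ ∈ goldTree G) := by
    intro τ hτ
    by_contra hn
    exact he ⟨τ, hτ, hn⟩
  constructor
  · rw [oneComplete_iff]
    refine fun ρ hρ => ⟨hG ρ hρ, fun j hj hjT => ?_⟩
    obtain ⟨i, rfl⟩ : ∃ i, j = i + 1 := ⟨j - 1, by omega⟩
    have hpre : ∀ i, ρ.take i ∈ goldTree G := fun i => Or.inr ⟨ρ, hρ, List.take_prefix _ _⟩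
    exact (hc _ (take_succ_mem_augmented (by rw [hG ρ hρ]; omega) (by omega) (hpre i))).2 (hpre _)
  · rintro τ ⟨hlen, hacc⟩
    -- An accepted trace cannot leave the tree: the first prefix outside would be an augmented
    -- example, hence answered NO.
    have htree : ∀ j ≤ T, τ.take j ∈ goldTree G := by
      intro j
      induction j with
      | zero => exact fun _ => Or.inl (by simp)
      | succ j ih =>
        exact fun hj => (hc _ (take_succ_mem_augmented (by omega) (by omega) (ih (by omega)))).1
          (hacc _ (by omega) hj)
    have hτ := htree T le_rfl
    rw [List.take_of_length_le hlen.le] at hτ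
    rcases hτ with rfl | ⟨ρ, hρ, hpre⟩
    · simp at hlen; omega
    · rwa [hpre.eq_of_length (hlen.trans (hG ρ hρ).symm)]

theorem Realizes.length_eq {T : ℕ} {hstar : Verifier X Step} {g : X → Set (List Step)}
    (hg : Realizes T hstar g) (x : X) : ∀ ρ ∈ g x, ρ.length = T := by
  intro ρ hρ
  rw [(hg x).1] at hρ
  exact hρ.1

theorem Realizes.not_errs {T : ℕ} {hstar : Verifier X Step} {g : X → Set (List Step)}
    (hg : Realizes T hstar g) (x : X) : ¬ Errs T hstar x (g x) := by
  rintro ⟨τ, hτ, hn⟩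
  by_cases ht : τ ∈ goldTree (g x)
  · refine hn ⟨fun _ => ht, fun _ => ?_⟩
    have h0 := ne_nil_of_mem_augmented hτ
    rcases ht with h | ⟨ρ, hρ, hpre⟩
    · exact absurd h h0
    · rw [(hg x).1] at hρ
      rw [List.prefix_iff_eq_take.1 hpre]
      exact hρ.2 _ (List.length_pos_iff.2 h0) (hρ.1 ▸ hpre.length_le)
  · exact hn (by simp [ht, (hg x).2 τ hτ ht])

/-- The nodes of length less than `T` are indexed by a gold trace and a length, the root being
shared. Without gold traces the root remains, which is why `k` and `T` must be positive. -/
theorem augmented_ncard_le [Fintype Step] {T k : ℕ} (hT : 1 ≤ T) (hk : 1 ≤ k)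
    {G : Set (List Step)} (hG : G.encard ≤ k) :
    (augmented T G).ncard ≤ k * T * Fintype.card Step := by
  have hGf : G.Finite := Set.finite_of_encard_le_coe hG
  have hGn : G.ncard ≤ k := by
    rw [← hGf.cast_ncard_eq] at hG
    exact_mod_cast hG
  obtain ⟨V, hVf, hVn, hV⟩ : ∃ V : Set (List Step), V.Finite ∧ V.ncard ≤ k * T ∧
      ∀ p ∈ goldTree G, p.length < T → p ∈ V := by
    obtain rfl | ⟨ρ₀, hρ₀⟩ := G.eq_empty_or_nonempty
    · refine ⟨{[]}, Set.finite_singleton _, ?_, ?_⟩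
      · rw [Set.ncard_singleton]
        exact Nat.mul_pos hk hT
      · rintro p (rfl | ⟨ρ, hρ, -⟩) _
        · rfl
        · exact absurd hρ (Set.notMem_empty ρ)
    · refine ⟨(fun q : List Step × ℕ => q.1.take q.2) '' (G ×ˢ Set.Iio T),
        (hGf.prod (Set.finite_Iio T)).image _, ?_, ?_⟩
      · refine (Set.ncard_image_le (hGf.prod (Set.finite_Iio T))).trans ?_
        rw [Set.ncard_prod]
        have : (Set.Iio T).ncard = T := by
          rw [← Finset.coe_Iio, Set.ncard_coe_finset, Nat.card_Iio]
        rw [this]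
        gcongr
      · rintro p (rfl | ⟨ρ, hρ, hpre⟩) hp
        · exact ⟨(ρ₀, 0), ⟨hρ₀, by simpa using hp⟩, by simp⟩
        · exact ⟨(ρ, p.length), ⟨hρ, hp⟩, (List.prefix_iff_eq_take.1 hpre).symm⟩
  calc (augmented T G).ncard
      ≤ ((fun q : List Step × Step => q.1 ++ [q.2]) '' (V ×ˢ Set.univ)).ncard := by
        refine Set.ncard_le_ncard ?_ ((hVf.prod Set.finite_univ).image _)
        rintro _ ⟨p, s, hp, hpT, rfl⟩
        exact ⟨(p, s), ⟨hV p hp hpT, trivial⟩, rfl⟩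
    _ ≤ (V ×ˢ (Set.univ : Set Step)).ncard := Set.ncard_image_le (hVf.prod Set.finite_univ)
    _ ≤ k * T * Fintype.card Step := by
        rw [Set.ncard_prod, Set.ncard_univ, Nat.card_eq_fintype_card]
        gcongr

theorem measurableSet_errs [MeasurableSpace X] [Countable Step] {T : ℕ}
    {h hstar : Verifier X Step} {g : X → Set (List Step)} (hg : Realizes T hstar g)
    (hm : ∀ τ, MeasurableSet {x | h x τ = true})
    (hmstar : ∀ τ, MeasurableSet {x | hstar x τ = true}) :
    MeasurableSet {x | Errs T h x (g x)} := by
  have h1 : ∀ τ, Measurable fun x => h x τ = true := fun τ => measurableSet_setOfPred.1 (hm τ)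
  have h2 : ∀ τ, Measurable fun x => hstar x τ = true := fun τ => measurableSet_setOfPred.1 (hmstar τ)
  have h3 : ∀ τ, Measurable fun x => τ ∈ g x := by
    intro τ
    have : (fun x => τ ∈ g x) = fun x => τ.length = T ∧ ∀ j, 1 ≤ j → j ≤ T →
        hstar x (τ.take j) = true := by
      funext x
      rw [(hg x).1]
      rfl
    rw [this]
    exact measurable_const.and (Measurable.forall fun j => measurable_const.imp
      (measurable_const.imp (h2 _)))
  have h4 : ∀ τ, Measurable fun x => τ ∈ goldTree (g x) := fun τ =>
    measurable_const.or (Measurable.exists fun ρ => (h3 ρ).and measurable_const)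
  have h5 : ∀ τ, Measurable fun x => τ ∈ augmented T (g x) := fun τ =>
    Measurable.exists fun p => Measurable.exists fun s => (h4 p).and measurable_const
  exact measurableSet_setOfPred.2 (Measurable.exists fun τ => (h5 τ).and ((h1 τ).iff (h4 τ)).not)

/-- Erring on a problem involves only finitely many answers, so it is stable under pointwise limits.
-/
theorem eventually_errs_iff [Finite Step] {T : ℕ} {w : ℕ → Verifier X Step} {h : Verifier X Step}
    (hw : ∀ x τ, ∀ᶠ n in atTop, w n x τ = h x τ) (x : X) (G : Set (List Step)) :
    ∀ᶠ n in atTop, (Errs T (w n) x G ↔ Errs T h x G) := by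
  have : ∀ᶠ n in atTop, ∀ τ ∈ augmented T G, w n x τ = h x τ :=
    (augmented_finite T G).eventually_all.2 fun τ _ => hw x τ
  filter_upwards [this] with n hn
  exact exists_congr fun τ => and_congr_right fun hτ => by rw [hn τ hτ]

theorem card_le_of_shatters {H : Set (Verifier X Step)} {d : ℕ} (hd : vcDim H = d)
    {P : Finset (X × List Step)} (hP : Shatters H P) : P.card ≤ d := by
  have : (P.card : ℕ∞) ≤ vcDim H := le_iSup₂_of_le P hP le_rfl
  rw [hd] at this
  exact_mod_cast this

/-- The Sauer-Shelah lemma for verifiers, in a multiplicative form. -/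
theorem pow_mul_card_patterns_le {H : Set (Verifier X Step)} {d : ℕ} (hd : vcDim H = d)
    [DecidableEq (X × List Step)] (Q : Finset (X × List Step))
    (𝒜 : Finset (Finset (X × List Step)))
    (h𝒜 : ∀ A ∈ 𝒜, ∃ h ∈ H, A = Q.filter fun q => h q.1 q.2 = true) {r : ℝ} (h0 : 0 < r)
    (h1 : r ≤ 1) : r ^ d * (𝒜.card : ℝ) ≤ (1 + r) ^ Q.card := by
  have hsub : ∀ s ∈ 𝒜.shatterer, s ⊆ Q ∧ s.card ≤ d := by
    intro s hs
    rw [Finset.mem_shatterer] at hs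
    have hsQ : s ⊆ Q := by
      obtain ⟨A, hA, hsA⟩ := hs.exists_superset
      obtain ⟨h, -, rfl⟩ := h𝒜 A hA
      exact hsA.trans (Finset.filter_subset _ _)
    refine ⟨hsQ, card_le_of_shatters hd fun t ht => ?_⟩
    obtain ⟨A, hA, hAt⟩ := hs ht
    obtain ⟨h, hH, rfl⟩ := h𝒜 A hA
    refine ⟨h, hH, fun p hp => ?_⟩
    rw [← hAt]
    simp [hp, hsQ hp]
  -- Pajor's inequality: a family shatters at least as many sets as it has members. As shattered
  -- sets have size at most `d`, `r ^ d ≤ r ^ s.card`, and the binomial theorem sums the weights.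
  calc r ^ d * (𝒜.card : ℝ) ≤ r ^ d * (𝒜.shatterer.card : ℝ) :=
        mul_le_mul_of_nonneg_left (by exact_mod_cast Finset.card_le_card_shatterer 𝒜)
          (by positivity)
    _ = ∑ s ∈ 𝒜.shatterer, r ^ d := by rw [Finset.sum_const, nsmul_eq_mul, mul_comm]
    _ ≤ ∑ s ∈ 𝒜.shatterer, r ^ s.card := Finset.sum_le_sum fun s hs =>
        pow_le_pow_of_le_one h0.le h1 (hsub s hs).2
    _ ≤ ∑ s ∈ Q.powerset, r ^ s.card := Finset.sum_le_sum_of_subset_of_nonneg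
        (fun s hs => Finset.mem_powerset.2 (hsub s hs).1) fun _ _ _ => by positivity
    _ = (1 + r) ^ Q.card := by
        rw [add_comm, ← Finset.sum_pow_mul_eq_add_pow]
        simp

/-- The answers of a verifier on all augmented examples of the problems in `P` determine on which of
these problems it errs, so Sauer-Shelah applies to those examples. -/
theorem traceBound_errs [Fintype Step] {H : Set (Verifier X Step)} {T k d : ℕ} (hT : 1 ≤ T)
    (hk : 1 ≤ k) (hd : vcDim H = d) {g : X → Set (List Step)} (hg : ∀ x, (g x).encard ≤ k)
    {h : ℕ → Verifier X Step} (hH : ∀ n, h n ∈ H) :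
    TraceBound (fun n => {x | Errs T (h n) x (g x)}) (k * T * Fintype.card Step) d := by
  classical
  intro r h0 h1 P
  set Q : Finset (X × List Step) := P.biUnion fun x =>
    (augmented_finite T (g x)).toFinset.image fun τ => (x, τ) with hQ
  have hmem : ∀ x τ, (x, τ) ∈ Q ↔ x ∈ P ∧ τ ∈ augmented T (g x) := by
    intro x τ
    simp [hQ]
  have hQcard : Q.card ≤ k * T * Fintype.card Step * P.card := by
    rw [mul_comm]
    refine Finset.card_biUnion_le_card_mul _ _ _ fun x _ => Finset.card_image_le.trans ?_
    rw [← Set.ncard_eq_toFinset_card _ (augmented_finite T (g x))]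
    exact augmented_ncard_le hT hk (hg x)
  set 𝒜 : Finset (Finset (X × List Step)) :=
    Q.powerset.filter fun A => ∃ n, A = Q.filter fun q => h n q.1 q.2 = true with h𝒜
  have hpat : (Set.range fun n => (P ∩ {x | Errs T (h n) x (g x)} : Set X)).ncard ≤ 𝒜.card := by
    rw [← Set.ncard_coe_finset]
    refine (Set.ncard_le_ncard (t := (fun A : Finset (X × List Step) => {x | x ∈ P ∧
      ∃ τ ∈ augmented T (g x), ¬ ((x, τ) ∈ A ↔ τ ∈ goldTree (g x))}) '' 𝒜) ?_
      (𝒜.finite_toSet.image _)).trans (Set.ncard_image_le 𝒜.finite_toSet)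
    rintro _ ⟨n, rfl⟩
    refine ⟨Q.filter fun q => h n q.1 q.2 = true, ?_, ?_⟩
    · simp only [h𝒜, Finset.coe_filter, Finset.mem_powerset, Set.mem_ofPred_eq]
      exact ⟨Finset.filter_subset _ _, n, rfl⟩
    · ext x
      refine and_congr_right fun hx => exists_congr fun τ => and_congr_right fun hτ => ?_
      rw [Finset.mem_filter, hmem]
      have hx' : x ∈ P := hx
      simp [hx', hτ]
  calc r ^ d * ((Set.range fun n => (P ∩ {x | Errs T (h n) x (g x)} : Set X)).ncard : ℝ)
      ≤ r ^ d * (𝒜.card : ℝ) := by gcongr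
    _ ≤ (1 + r) ^ Q.card := by
        refine pow_mul_card_patterns_le hd Q 𝒜 (fun A hA => ?_) h0 h1
        obtain ⟨-, n, hn⟩ := Finset.mem_filter.1 hA
        exact ⟨h n, hH n, hn⟩
    _ ≤ _ := pow_le_pow_right₀ (by linarith) hQcard

theorem PointwiseSeparable.exists_seq {H : Set (Verifier X Step)} (hH : PointwiseSeparable H)
    (hne : H.Nonempty) : ∃ h : ℕ → Verifier X Step, (∀ n, h n ∈ H) ∧ ∀ v ∈ H, ∃ w : ℕ → ℕ,
      ∀ x τ, ∀ᶠ n in atTop, h (w n) x τ = v x τ := by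
  obtain ⟨H₀, hsub, hcount, hlim⟩ := hH
  have hne₀ : H₀.Nonempty := by
    obtain ⟨v, hv⟩ := hne
    obtain ⟨w, hw, -⟩ := hlim v hv
    exact ⟨w 0, hw 0⟩
  obtain ⟨h, rfl⟩ := hcount.exists_eq_range hne₀
  refine ⟨h, fun n => hsub ⟨n, rfl⟩, fun v hv => ?_⟩
  obtain ⟨w, hw, hwv⟩ := hlim v hv
  choose e he using hw
  refine ⟨e, fun x τ => ?_⟩
  simpa only [he] using hwv x τ

/-- The realizing verifier need not occur in the sequence, but a finite sample cannot tell it from a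
late approximant. -/
theorem exists_consistent [Finite Step] {T : ℕ} {h : ℕ → Verifier X Step} {hstar : Verifier X Step}
    {g : X → Set (List Step)} (hg : Realizes T hstar g) {w : ℕ → ℕ}
    (hw : ∀ x τ, ∀ᶠ n in atTop, h (w n) x τ = hstar x τ) {ι : Type*} (S : ι → X) (A : Finset ι) :
    ∃ n, ∀ i ∈ A, ¬ Errs T (h n) (S i) (g (S i)) := by
  have : ∀ᶠ n in atTop, ∀ i ∈ A, ¬ Errs T (h (w n)) (S i) (g (S i)) := by
    refine (Finset.eventually_all A).2 fun i _ => ?_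
    filter_upwards [eventually_errs_iff hw (S i) (g (S i))] with n hn
    rw [hn]
    exact hg.not_errs (S i)
  obtain ⟨n, hn⟩ := this.exists
  exact ⟨w n, hn⟩

/-- An empirical risk minimizer over a class that realizes the gold standard makes no error on the
sample. -/
theorem IsERM.not_errs [Finite Step] {T : ℕ} {H : Set (Verifier X Step)} {A : Learner X Step}
    (hA : IsERM T H A) {hstar : Verifier X Step} (hstarH : hstar ∈ H) {g : X → Set (List Step)}
    (hg : Realizes T hstar g) {m : ℕ} (S : Fin m → X) (i : Fin m) :
    ¬ Errs T (A m fun i => (S i, g (S i))) (S i) (g (S i)) := by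
  have h0 : empiricalRisk T (fun i => (S i, g (S i))) hstar = 0 := by
    refine Finset.sum_eq_zero fun i _ => ?_
    rw [Set.ncard_eq_zero ((augmented_finite T _).subset fun τ hτ => hτ.1)]
    refine Set.eq_empty_iff_forall_notMem.2 fun τ hτ => hg.not_errs (S i) ⟨τ, hτ.1, hτ.2⟩
  have h1 := (hA m fun i => (S i, g (S i))).2 hstar hstarH
  rw [h0, Nat.le_zero] at h1
  have h2 := Finset.sum_eq_zero_iff.1 h1 i (Finset.mem_univ i)
  rw [Set.ncard_eq_zero ((augmented_finite T _).subset fun τ hτ => hτ.1)] at h2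
  rintro ⟨τ, hτ, hn⟩
  exact Set.eq_empty_iff_forall_notMem.1 h2 τ ⟨hτ, hn⟩

theorem exists_isERM (T : ℕ) {H : Set (Verifier X Step)} (hne : H.Nonempty) :
    ∃ A : Learner X Step, IsERM T H A := by
  have : ∀ (m : ℕ) (S : Fin m → X × Set (List Step)), ∃ h ∈ H, ∀ h' ∈ H,
      empiricalRisk T S h ≤ empiricalRisk T S h' := by
    intro m S
    obtain ⟨h, hh, hmin⟩ := (InvImage.wf (empiricalRisk T S) Nat.lt_wfRel.wf).has_min H hne
    exact ⟨h, hh, fun h' hh' => not_lt.1 (hmin h' hh')⟩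
  choose A hA using this
  exact ⟨A, hA⟩

end Verifiers

/-! ### The two learners -/

section Learners

variable {X : Type u} {Step : Type v}

/-- Among the `3 ^ s` verifiers that recursive subsampling trains on the blocks of level below `s`
and the common set `A`, the number of those that answer YES. -/
noncomputable def yesCount {ι : Type*} [DecidableEq ι] (T : ℕ) (h : ℕ → Verifier X Step)
    (c : ℕ → Fin 3 → Finset ι) : ℕ → Finset ι → (ι → X × Set (List Step)) → X → List Step → ℕ
  | 0, A, S, x, τ => if h (firstConsistent (fun n => {q | Errs T (h n) q.1 q.2}) S A) x τ then 1
      else 0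
  | s + 1, A, S, x, τ => ∑ i, yesCount T h c s (addBlocks c s A i) S x τ

/-- The blocks of a sample of size `m`: three blocks of size `4 ^ s` for each level `s`. -/
def sampleBlock (m s : ℕ) (j : Fin 3) : Finset (Fin m) :=
  Finset.univ.filter fun i => 4 ^ s * (1 + j) ≤ (i : ℕ) + 1 ∧ (i : ℕ) + 1 < 4 ^ s * (2 + j)

/-- The majority vote of the verifiers that recursive subsampling trains. -/
noncomputable def majorityLearner (T : ℕ) (h : ℕ → Verifier X Step) : Learner X Step :=
  fun m S x τ => decide (3 ^ Nat.log 4 (m + 1) <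
    2 * yesCount T h (sampleBlock m) (Nat.log 4 (m + 1)) ∅ S x τ)

/-- In base 4, the block of `i` is read off `i + 1`: the level is the number of digits minus one,
and the leading digit is `1 + j`. -/
theorem sampleBlock_disjoint (m s : ℕ) (i : Fin 3) (s' : ℕ) (j : Fin 3) (h : (s, i) ≠ (s', j)) :
    Disjoint (sampleBlock m s i) (sampleBlock m s' j) := by
  have key : ∀ {s s' : ℕ} (i j : Fin 3), s < s' → ∀ a : Fin m, a ∈ sampleBlock m s i →
      a ∉ sampleBlock m s' j := by
    intro s s' i j hs a ha hb
    simp only [sampleBlock, Finset.mem_filter, Finset.mem_univ, true_and] at ha hb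
    have h1 : 4 ^ s * (2 + (i : ℕ)) ≤ 4 ^ s * 4 := Nat.mul_le_mul_left _ (by omega)
    have h2 : 4 ^ s * 4 ≤ 4 ^ s' := by
      rw [← pow_succ]
      exact Nat.pow_le_pow_right (by norm_num) hs
    have h3 : 4 ^ s' * 1 ≤ 4 ^ s' * (1 + (j : ℕ)) := Nat.mul_le_mul_left _ (by omega)
    omega
  refine Finset.disjoint_left.2 fun a ha hb => ?_
  rcases lt_trichotomy s s' with hs | rfl | hs
  · exact key i j hs a ha hb
  · simp only [sampleBlock, Finset.mem_filter, Finset.mem_univ, true_and] at ha hb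
    have h1 : 1 + (i : ℕ) < 2 + j := lt_of_mul_lt_mul_left (ha.1.trans_lt hb.2) (Nat.zero_le _)
    have h2 : 1 + (j : ℕ) < 2 + i := lt_of_mul_lt_mul_left (hb.1.trans_lt ha.2) (Nat.zero_le _)
    exact h (by rw [Fin.ext (by omega : (i : ℕ) = j)])
  · exact key j i hs a hb ha

theorem le_card_sampleBlock {m s : ℕ} (hs : 4 ^ (s + 1) ≤ m + 1) (j : Fin 3) :
    4 ^ s ≤ (sampleBlock m s j).card := by
  have hsub : Finset.Ico (4 ^ s * (1 + (j : ℕ))) (4 ^ s * (2 + j)) ⊆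
      (sampleBlock m s j).image fun i : Fin m => (i : ℕ) + 1 := by
    intro a ha
    rw [Finset.mem_Ico] at ha
    have h1 : 4 ^ s * (2 + (j : ℕ)) ≤ 4 ^ s * 4 := Nat.mul_le_mul_left _ (by omega)
    have h2 : 4 ^ s * 1 ≤ 4 ^ s * (1 + (j : ℕ)) := Nat.mul_le_mul_left _ (by omega)
    have h3 : 0 < 4 ^ s := by positivity
    rw [pow_succ] at hs
    refine Finset.mem_image.2 ⟨⟨a - 1, by omega⟩, ?_, by simp; omega⟩
    simp only [sampleBlock, Finset.mem_filter, Finset.mem_univ, true_and]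
    constructor <;> omega
  calc 4 ^ s = (Finset.Ico (4 ^ s * (1 + (j : ℕ))) (4 ^ s * (2 + j))).card := by
        rw [Nat.card_Ico, ← Nat.mul_sub, show 2 + (j : ℕ) - (1 + j) = 1 by omega, mul_one]
    _ ≤ _ := (Finset.card_le_card hsub).trans Finset.card_image_le

/-- A wrong vote on one trace is an error on the whole problem. Counting errors per problem thus
controls the votes on all its augmented traces at once. -/
theorem yesCount_spec {ι : Type*} [DecidableEq ι] {T : ℕ} (h : ℕ → Verifier X Step)
    (g : X → Set (List Step)) (c : ℕ → Fin 3 → Finset ι) (S : ι → X) {x : X} {τ : List Step}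
    (hτ : τ ∈ augmented T (g x)) (s : ℕ) (A : Finset ι) :
    (τ ∈ goldTree (g x) → 3 ^ s ≤ yesCount T h c s A (fun i => (S i, g (S i))) x τ +
        errCount (fun n => {x | Errs T (h n) x (g x)}) c s A S x) ∧
      (τ ∉ goldTree (g x) → yesCount T h c s A (fun i => (S i, g (S i))) x τ ≤
        errCount (fun n => {x | Errs T (h n) x (g x)}) c s A S x) := by
  induction s generalizing A with
  | zero =>
    have hfc : firstConsistent (fun n => {q : X × Set (List Step) | Errs T (h n) q.1 q.2})
        (fun i => (S i, g (S i))) A =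
        firstConsistent (fun n => {x | Errs T (h n) x (g x)}) S A := rfl
    simp only [yesCount, errCount, hfc]
    set n := firstConsistent (fun n => {x | Errs T (h n) x (g x)}) S A
    by_cases he : Errs T (h n) x (g x)
    · have hx : x ∈ {x | Errs T (h n) x (g x)} := he
      rw [Set.indicator_of_mem hx]
      split_ifs <;> simp
    · have hx : x ∉ {x | Errs T (h n) x (g x)} := he
      rw [Set.indicator_of_notMem hx]
      have hiff : h n x τ = true ↔ τ ∈ goldTree (g x) := by
        by_contra hn
        exact he ⟨τ, hτ, hn⟩
      rw [← hiff]
      constructor <;> intro h' <;> simp [h']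
  | succ s ih =>
    simp only [yesCount, errCount]
    constructor
    · intro ht
      rw [← Finset.sum_add_distrib]
      calc 3 ^ (s + 1) = ∑ _i : Fin 3, 3 ^ s := by simp [pow_succ']
        _ ≤ _ := Finset.sum_le_sum fun i _ => (ih _).1 ht
    · exact fun ht => Finset.sum_le_sum fun i _ => (ih _).2 ht

theorem not_errs_majorityLearner {T m : ℕ} (h : ℕ → Verifier X Step) (g : X → Set (List Step))
    (S : Fin m → X) {x : X}
    (hx : x ∉ majorityError (fun n => {x | Errs T (h n) x (g x)}) (sampleBlock m)
      (Nat.log 4 (m + 1)) ∅ S) :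
    ¬ Errs T (majorityLearner T h m fun i => (S i, g (S i))) x (g x) := by
  rintro ⟨τ, hτ, hn⟩
  have hspec := yesCount_spec h g (sampleBlock m) S hτ (Nat.log 4 (m + 1)) ∅
  simp only [majorityError, Set.mem_ofPred_eq, not_le] at hx
  refine hn ?_
  simp only [majorityLearner, decide_eq_true_eq]
  by_cases ht : τ ∈ goldTree (g x)
  · have := hspec.1 ht
    simp only [ht, iff_true]
    omega
  · have := hspec.2 ht
    simp only [ht, iff_false]
    omega

/-- The majority vote over recursive subsamples learns with the optimal sample size. -/
theorem tvpacLearns_majorityLearner [MeasurableSpace X] [Fintype Step] {T k d : ℕ}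
    {H : Set (Verifier X Step)} (hN : 2 ≤ k * T * Fintype.card Step)
    (hm : ∀ h ∈ H, ∀ τ, MeasurableSet {x | h x τ = true}) (hvc : vcDim H = d) (hd : 1 ≤ d)
    {h : ℕ → Verifier X Step} (hH : ∀ n, h n ∈ H)
    (hlim : ∀ v ∈ H, ∃ w : ℕ → ℕ, ∀ x τ, ∀ᶠ n in atTop, h (w n) x τ = v x τ) {C : ℝ}
    (hC : 12288 ≤ C) :
    TVPACLearns T k H (majorityLearner T h) (fun ε δ =>
      C * (1 / ε) * (d * Real.log (k * T * Fintype.card Step) + Real.log (1 / δ))) := by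
  intro hstar hstarH g hg hgk ε δ hε hε1 hδ hδ1 D _ m hM
  have hT : 1 ≤ T := Nat.one_le_iff_ne_zero.2 (by rintro rfl; simp at hN)
  have hk : 1 ≤ k := Nat.one_le_iff_ne_zero.2 (by rintro rfl; simp at hN)
  set N := k * T * Fintype.card Step with hNdef
  set t := Nat.log 4 (m + 1) with ht
  set B : ℕ → Set X := fun n => {x | Errs T (h n) x (g x)} with hB
  obtain ⟨w, hw⟩ := hlim hstar hstarH
  have hcast : ((k : ℝ) * T * Fintype.card Step) = N := by rw [hNdef]; push_cast; ring
  beta_reduce at hM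
  rw [hcast] at hM
  set L := d * Real.log N + Real.log (1 / δ) with hL
  have key := measure_majorityError_gt_le D (B := B) (N := N) (d := d) (t := t)
    (fun n => measurableSet_errs hg (hm _ (hH n)) (hm _ hstarH)) hN hd
    (traceBound_errs hT hk hvc hgk hH) (fun S A => exists_consistent hg hw S A)
    (sampleBlock_disjoint m)
    (fun s hs j => le_card_sampleBlock ((Nat.pow_le_pow_right (by norm_num) hs).trans
      (Nat.pow_log_le_self 4 (by omega))) j) t le_rfl ∅ (by simp) δ hδ hδ1
  refine (measure_mono fun S hS => ?_).trans key
  have hL0 : 0 ≤ L := by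
    have : 0 < Real.log (1 / δ) := Real.log_pos (by rw [lt_div_iff₀ hδ]; linarith)
    positivity
  -- Rounding down to a power of 4 loses a factor below 4, hence `12288 = 4 * 3072`.
  have hlt : (m : ℝ) + 1 < 4 * 4 ^ t := by
    have := Nat.lt_pow_succ_log_self (b := 4) (by norm_num) (m + 1)
    rw [pow_succ'] at this
    exact_mod_cast this
  have hle : 3072 / 4 ^ t * L ≤ ε := by
    rw [div_mul_eq_mul_div, div_le_iff₀ (by positivity)]
    have h1 : C * L ≤ m * ε := by
      rw [mul_one_div, div_mul_eq_mul_div, div_le_iff₀ hε] at hM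
      exact hM
    nlinarith
  have hS' : ENNReal.ofReal ε < D {x | ¬ (OneComplete T (majorityLearner T h m fun i =>
      (S i, g (S i))) x (g x) ∧ Sound T (majorityLearner T h m fun i => (S i, g (S i))) x (g x))} :=
    hS
  refine ((ENNReal.ofReal_le_ofReal hle).trans_lt hS').trans_le (measure_mono fun x hx => ?_)
  by_contra hmaj
  exact hx (oneComplete_and_sound_of_not_errs hT (hg.length_eq x)
    (not_errs_majorityLearner h g S hmaj))

/-- An empirical risk minimizer that fails witnesses a failure within a countable dense subclass. -/
theorem exists_large_error_of_large_error [MeasurableSpace X] [Finite Step] {T m : ℕ}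
    {h : ℕ → Verifier X Step} {v : Verifier X Step} {w : ℕ → ℕ}
    (hw : ∀ x τ, ∀ᶠ n in atTop, h (w n) x τ = v x τ) (g : X → Set (List Step)) (D : Measure X)
    {ε : ℝ≥0∞} (hε : ε < D {x | Errs T v x (g x)}) (S : Fin m → X)
    (hS : ∀ i, ¬ Errs T v (S i) (g (S i))) :
    ∃ n, ε < D {x | Errs T (h n) x (g x)} ∧ ∀ i, ¬ Errs T (h n) (S i) (g (S i)) := by
  -- These sets increase and cover the error set of `v`, so by continuity from below one of them
  -- already has measure more than `ε`; any later approximant errs on it.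
  set G : ℕ → Set X := fun a => {x | ∀ n ≥ a, Errs T (h (w n)) x (g x)} with hG
  have hmono : Monotone G := fun a b hab x hx n hn => hx n (hab.trans hn)
  have hsub : {x | Errs T v x (g x)} ⊆ ⋃ a, G a := by
    intro x hx
    obtain ⟨a, ha⟩ := eventually_atTop.1 (eventually_errs_iff hw x (g x))
    exact Set.mem_iUnion.2 ⟨a, fun n hn => (ha n hn).2 hx⟩
  have hlt := hε.trans_le (measure_mono hsub)
  rw [hmono.measure_iUnion, lt_iSup_iff] at hlt
  obtain ⟨a, ha⟩ := hlt
  have hev : ∀ᶠ n in atTop, ∀ i, ¬ Errs T (h (w n)) (S i) (g (S i)) := by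
    refine eventually_all.2 fun i => ?_
    filter_upwards [eventually_errs_iff hw (S i) (g (S i))] with n hn
    rw [hn]
    exact hS i
  obtain ⟨n, hn, han⟩ := (hev.and (eventually_ge_atTop a)).exists
  exact ⟨w n, ha.trans_le (measure_mono fun x hx => hx n han), hn⟩

theorem erm_bound {q ε δ : ℝ} {d m : ℕ} (hq : 2 ≤ q) (hε : 0 < ε) (hδ : 0 < δ) {C : ℝ}
    (hC : 20 ≤ C) (hpos : 0 ≤ d * Real.log q + Real.log (1 / δ)) (hlδ : 0 ≤ Real.log (1 / δ))
    (hM : C * (1 / ε) * (d * Real.log q + Real.log (1 / δ)) ≤ m) :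
    (16 * q) ^ d * Real.exp (-(m * ε / 4)) ≤ δ := by
  have h1 : C * (d * Real.log q + Real.log (1 / δ)) ≤ m * ε := by
    rw [mul_one_div, div_mul_eq_mul_div, div_le_iff₀ hε] at hM
    exact hM
  have h2 : 20 * (d * Real.log q + Real.log (1 / δ)) ≤ m * ε :=
    (mul_le_mul_of_nonneg_right hC hpos).trans h1
  have h3 := log_mul_le (a := 4) (c := 16) (by norm_num) (by norm_num) hq
  have h4 : d * Real.log (16 * q) ≤ 5 * (d * Real.log q) := by
    calc (d : ℝ) * Real.log (16 * q) ≤ d * ((4 + 1) * Real.log q) := by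
          gcongr; exact_mod_cast h3
      _ = 5 * (d * Real.log q) := by ring
  calc (16 * q) ^ d * Real.exp (-(m * ε / 4))
      = Real.exp (d * Real.log (16 * q) - m * ε / 4) := by
        rw [sub_eq_add_neg, Real.exp_add, Real.exp_nat_mul, Real.exp_log (by positivity)]
    _ ≤ Real.exp (Real.log δ) := by
        refine Real.exp_le_exp.2 ?_
        rw [one_div, Real.log_inv] at h2 hlδ
        linarith
    _ = δ := Real.exp_log hδ

/-- Empirical risk minimization over a class of finite VC dimension. -/
theorem tvpacLearns_of_isERM [MeasurableSpace X] [Fintype Step] {T k d : ℕ}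
    {H : Set (Verifier X Step)} (hN : 2 ≤ k * T * Fintype.card Step)
    (hm : ∀ h ∈ H, ∀ τ, MeasurableSet {x | h x τ = true}) (hvc : vcDim H = d)
    (hsep : PointwiseSeparable H) {A : Learner X Step} (hA : IsERM T H A) {C : ℝ} (hC : 20 ≤ C) :
    TVPACLearns T k H A (fun ε δ =>
      C * (1 / ε) * (d * Real.log (k * T * Fintype.card Step / ε) + Real.log (1 / δ))) := by
  intro hstar hstarH g hg hgk ε δ hε hε1 hδ hδ1 D _ m hM
  have hT : 1 ≤ T := Nat.one_le_iff_ne_zero.2 (by rintro rfl; simp at hN)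
  have hk : 1 ≤ k := Nat.one_le_iff_ne_zero.2 (by rintro rfl; simp at hN)
  obtain ⟨h, hH, hlim⟩ := hsep.exists_seq ⟨hstar, hstarH⟩
  set N := k * T * Fintype.card Step with hNdef
  have hcast : ((k : ℝ) * T * Fintype.card Step) = N := by rw [hNdef]; push_cast; ring
  beta_reduce at hM
  rw [hcast] at hM
  have hN2 : (2 : ℝ) ≤ N := by exact_mod_cast hN
  have hq : 2 ≤ N / ε := by
    rw [le_div_iff₀ hε]
    nlinarith
  have hlδ : 0 ≤ Real.log (1 / δ) := Real.log_nonneg (by rw [le_div_iff₀ hδ]; linarith)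
  have hlq : 0 ≤ Real.log (N / ε) := Real.log_nonneg (by linarith)
  -- No localization here: the region is the whole space and `p = 1`.
  have key := measure_exists_consistent_inter_le (ι := Fin m) D
    (B := fun n => {x | Errs T (h n) x (g x)}) (E := Set.univ) (p := 1) (N := N) (d := d)
    (fun n => measurableSet_errs hg (hm _ (hH n)) (hm _ hstarH)) (by omega)
    (traceBound_errs hT hk hvc hgk hH) MeasurableSet.univ hε hε1.le hε1.le (by simp)
  rw [Fintype.card_fin, mul_one, mul_div_assoc] at key
  refine (measure_mono fun S hS => ?_).trans (key.trans (ENNReal.ofReal_le_ofReal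
    (erm_bound hq hε hδ hC (by positivity) hlδ hM)))
  set v := A m fun i => (S i, g (S i)) with hv
  have hS' : ENNReal.ofReal ε < D {x | ¬ (OneComplete T v x (g x) ∧ Sound T v x (g x))} := hS
  obtain ⟨w, hw⟩ := hlim v (hA m _).1
  have hle : D {x | ¬ (OneComplete T v x (g x) ∧ Sound T v x (g x))} ≤
      D {x | Errs T v x (g x)} := by
    refine measure_mono fun x hx => ?_
    by_contra he
    exact hx (oneComplete_and_sound_of_not_errs hT (hg.length_eq x) he)
  obtain ⟨n, hn, hSn⟩ := exists_large_error_of_large_error hw g D (hS'.trans_le hle) S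
    (hA.not_errs hstarH hg S)
  exact ⟨n, by simpa using hn, hSn⟩

end Learners

end TVPAC


/-! ### The theorem -/

theorem mainTheorem2 :
    ∃ C : ℝ, 0 < C ∧
      ∀ (X : Type u) [MeasurableSpace X] (Step : Type v) [Fintype Step] (T k d : ℕ)
        (H : Set (TVPAC.Verifier X Step)),
        2 ≤ k * T * Fintype.card Step →
        (∀ h ∈ H, ∀ τ, MeasurableSet {x | h x τ = true}) →
        TVPAC.PointwiseSeparable H →
        TVPAC.vcDim H = d →
        (∃ A : TVPAC.Learner X Step, TVPAC.TVPACLearns T k H A (fun ε δ =>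
          C * (1 / ε) * (d * Real.log (k * T * Fintype.card Step) + Real.log (1 / δ)))) ∧
        (∀ A : TVPAC.Learner X Step, TVPAC.IsERM T H A → TVPAC.TVPACLearns T k H A (fun ε δ =>
          C * (1 / ε) *
            (d * Real.log (k * T * Fintype.card Step / ε) + Real.log (1 / δ)))) := by
  refine ⟨12288, by norm_num, fun X _ Step _ T k d H hN hm hsep hvc => ⟨?_, fun A hA =>
    TVPAC.tvpacLearns_of_isERM hN hm hvc hsep hA (by norm_num)⟩⟩
  obtain rfl | hne := H.eq_empty_or_nonempty
  · exact ⟨fun _ _ _ _ => true, fun hstar hstarH => absurd hstarH (Set.notMem_empty _)⟩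
  -- For `d = 0` there is no `d * log N` to absorb `log 6` in the recursion, but the two sample
  -- sizes coincide, so an empirical risk minimizer suffices.
  rcases Nat.eq_zero_or_pos d with rfl | hd
  · obtain ⟨A, hA⟩ := TVPAC.exists_isERM T hne
    refine ⟨A, ?_⟩
    have h := TVPAC.tvpacLearns_of_isERM (C := 12288) hN hm hvc hsep hA (by norm_num)
    simpa only [Nat.cast_zero, zero_mul] using h
  · obtain ⟨h, hH, hlim⟩ := hsep.exists_seq hne
    exact ⟨_, TVPAC.tvpacLearns_majorityLearner hN hm hvc hd hH hlim le_rfl⟩
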